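/- **Setting.** Let $n=(n_1,\dots,n_k)^T$ be a table of counts with positive mean vector $m=E[n]$, $N=\sum_i m_i$, obtained either by independent Poisson sampling ($c=0$, no matrix $X_0$) or by product-multinomial sampling: the cells are partitioned into $c\ge 1$ subtables with prefixed totals, the subtables are independent multinomial vectors, and $X_0$ is the $k\times c$ matrix of indicators of the subtables. A *loglinear model with linear constraints* (LMLC) $M_b$ is the set of mean vectors $m(\theta)=\exp(X_b\theta)$, $\theta\in\Theta_b=\{\theta\in\mathbb R^{t_b}: X_0^Tm(\theta)=X_0^Tn,\ C_b^Tm(\theta)=d_b^*\}$, where $X_b$ is a $k\times t_b$ matrix of rank $t_b$ whose column space $\mathcal C(X_b)$ contains $(1,\dots,1)^T$ and $\mathcal C(X_0)$, $C_b$ is $k\times r_b$, $c+r_b\le t_b$, and $L_b=(X_0,C_b)$ has rank $c+r_b$. Let $M_1,\dots,M_B$ ($B\ge2$) be nested LMLC: for $1\le b<B$, $\mathcal C(X_{b+1})\subset\mathcal C(X_b)$, $\mathcal C(L_b)\subset\mathcal C(L_{b+1})$, $t_{b+1}\le t_b$, $r_{b+1}\ge r_b$, at least one of the last two inequalities being strict.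 Let $\Phi$ be the class of convex $\phi:[0,\infty)\to\mathbb R\cup\{\infty\}$, finite and differentiable on $(0,\infty)$, with $\phi(1)=\phi'(1)=0$, $\phi''(1)>0$, and let $D_\phi(a,b)=\sum_i b_i\phi(a_i/b_i)$. For $\phi_1,\phi_2\in\Phi$ let $\widehat\theta_b$ be a minimum $\phi_2$-divergence estimator in $M_b$, i.e. a function of the table that minimizes $D_{\phi_2}(n,m(\theta))$ over $\theta\in\Theta_b$ whenever a minimizer exists (it is arbitrary otherwise). To test $H_{Null}(b):M_{b+1}$ against $H_{Alt}(b):M_b-M_{b+1}$ use $$T_b=\frac{2}{\phi_1''(1)}D_{\phi_1}\big(m(\widehat\theta_b),m(\widehat\theta_{b+1})\big)\quad\text{or}\quad S_b=\frac{2}{\phi_2''(1)}\Big(D_{\phi_2}(n,m(\widehat\theta_{b+1}))-D_{\phi_2}(n,m(\widehat\theta_b))\Big),$$ and reject when the statistic exceeds $\chi^2_{df_b}\big((1-\alpha)^{1/(B-1)}\big)$, the quantile of order $(1-\alpha)^{1/(B-1)}$ of the chi-square distribution with $df_b=t_b-t_{b+1}-r_b+r_{b+1}$ degrees of freedom, where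 $0<\alpha<1$. The tests $b=1,\dots,B-1$ are performed successively until one rejects. Asymptotics are for $N\to\infty$ (along values for which the prefixed subtable totals are integers) with $p=m/N$, all $X_b$, $C_b$ and all $d_b^*/N$ fixed. **Theorem.** Let $D_p=\operatorname{diag}(p)$. 1. For $1\le b\le B-1$, if the true mean vector lies in $M_b$ and in $M_{b+1}$ and $X_{b+1}^TD_pL_{b+1}$ has full column rank $c+r_{b+1}$, then the $b$-th test (based on $T_b$, or on $S_b$) has asymptotic size $1-(1-\alpha)^{1/(B-1)}$: its probability of rejection tends to $1-(1-\alpha)^{1/(B-1)}$. 2. If the true mean vector lies in all the models $M_1,\dots,M_B$ (all null hypotheses hold) and $X_B^TD_pL_B$ has full column rank $c+r_B$, then the overall asymptotic size of the sequence of $B-1$ tests is $\alpha$: the probability that at least one of the $B-1$ tests based on $T_1,\dots,T_{B-1}$ rejects tends to $\alpha$ as $N\to\infty$, and the same holds for the tests based on $S_1,\dots,S_{B-1}$. -/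

import Mathlib

open MeasureTheory ProbabilityTheory Filter Topology Matrix
open scoped ENNReal NNReal

noncomputable section

/-- Sampling plan of a contingency table with `k` cells: independent Poisson counts, or
product-multinomial sampling with `c` subtables, cell `i` belonging to subtable `stratum i`
(multinomial sampling is `c = 1`). -/
inductive SamplingPlan (k : ℕ) : Type
  | poisson : SamplingPlan k
  | productMultinomial (c : ℕ) (stratum : Fin k → Fin c) : SamplingPlan k

namespace SamplingPlan

variable {k : ℕ}

/-- Number `c` of linear restrictions due to the sampling plan (`0` for Poisson sampling). -/
def c : SamplingPlan k → ℕ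
  | poisson => 0
  | productMultinomial c _ => c

/-- The `k × c` matrix `X₀` whose `h`-th column is the indicator of the `h`-th subtable
(no column for Poisson sampling). -/
def X0 : (S : SamplingPlan k) → Matrix (Fin k) (Fin S.c) ℝ
  | poisson => fun _ h => h.elim0
  | productMultinomial c stratum => fun i (h : Fin c) => if stratum i = h then 1 else 0

open Classical in
/-- Probability of the table `n` under product-multinomial sampling with mean vector `m`:
independent multinomials with fixed subtable totals `N_h = ∑_{i ∈ h} m_i`
and cell probabilities `m_i / N_h`. -/
def productMultinomialWeight {c : ℕ} (stratum : Fin k → Fin c) (m : Fin k → ℝ)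
    (n : Fin k → ℕ) : ℝ :=
  if ∀ h, (∑ i with stratum i = h, (n i : ℝ)) = ∑ i with stratum i = h, m i then
    ∏ h, ((Nat.multinomial {i | stratum i = h} n : ℝ) *
      ∏ i with stratum i = h, (m i / ∑ i' with stratum i' = h, m i') ^ n i)
  else 0

/-- Law of the table of counts when its mean vector is `m`. -/
def law : SamplingPlan k → (Fin k → ℝ) → Measure (Fin k → ℕ)
  | poisson, m => Measure.pi fun i => poissonMeasure (m i).toNNReal
  | productMultinomial _ stratum, m =>
      Measure.sum fun n => ENNReal.ofReal (productMultinomialWeight stratum m n) • Measure.dirac n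

/-- The prefixed subtable totals are natural numbers (no condition for Poisson sampling). -/
def Admissible (S : SamplingPlan k) (m : Fin k → ℝ) : Prop :=
  ∀ h, ∃ a : ℕ, (S.X0ᵀ *ᵥ m) h = a

end SamplingPlan

/-- A loglinear model with linear constraints (LMLC): `log m(θ) = X θ`, `Lᵀ m(θ) = d`, where
`L = (X₀, C)` and `d = (X₀ᵀ n, d*)`.  Asymptotics are taken with `m / N` fixed, so that the
right-hand side of the additional constraints is `d* = N δ`; `δ` is the field `dstar`
(`dstar = 0` gives the constraints `Cᵀ m(θ) = 0`). -/
structure LMLC {k : ℕ} (S : SamplingPlan k) where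
  t : ℕ
  r : ℕ
  X : Matrix (Fin k) (Fin t) ℝ
  C : Matrix (Fin k) (Fin r) ℝ
  dstar : Fin r → ℝ
  rank_X : X.rank = t
  one_mem : (fun _ => 1) ∈ LinearMap.range X.mulVecLin
  strata_le : LinearMap.range S.X0.mulVecLin ≤ LinearMap.range X.mulVecLin
  le_t : S.c + r ≤ t
  rank_L : (Matrix.fromCols S.X0 C).rank = S.c + r

namespace LMLC

variable {k : ℕ} {S : SamplingPlan k}

/-- `L = (X₀, C)`. -/
def L (M : LMLC S) : Matrix (Fin k) (Fin S.c ⊕ Fin M.r) ℝ := Matrix.fromCols S.X0 M.C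

/-- Mean vector `m(θ) = exp (X θ)`. -/
def mean (M : LMLC S) (θ : Fin M.t → ℝ) : Fin k → ℝ := fun i => Real.exp ((M.X *ᵥ θ) i)

/-- Parameter space `Θ = {θ : Lᵀ m(θ) = d}` with `d = (X₀ᵀ n, N δ)`. -/
def paramSpace (M : LMLC S) (N : ℝ) (n : Fin k → ℝ) : Set (Fin M.t → ℝ) :=
  {θ | M.Lᵀ *ᵥ M.mean θ = Sum.elim (S.X0ᵀ *ᵥ n) (N • M.dstar)}

/-- The mean vector `m` obeys the model at scale `N`: `m = m(θ₀)` for some `θ₀ ∈ Θ`.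
(The subtable totals `X₀ᵀ n` are prefixed, hence equal to `X₀ᵀ m`.) -/
def Holds (M : LMLC S) (N : ℝ) (m : Fin k → ℝ) : Prop :=
  ∃ θ ∈ M.paramSpace N m, M.mean θ = m

/-- The constraints are not redundant at the normalized mean vector `p`: the matrix
`Xᵀ D_p L` has full column rank. -/
def RegularAt (M : LMLC S) (p : Fin k → ℝ) : Prop :=
  (M.Xᵀ * Matrix.diagonal p * M.L).rank = S.c + M.r

/-- `M'` is nested within `M`. -/
def NestedWithin (M' M : LMLC S) : Prop :=
  LinearMap.range M'.X.mulVecLin ≤ LinearMap.range M.X.mulVecLin ∧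
  LinearMap.range M.L.mulVecLin ≤ LinearMap.range M'.L.mulVecLin ∧
  M'.t ≤ M.t ∧ M.r ≤ M'.r ∧ (M'.t < M.t ∨ M.r < M'.r)

/-- Degrees of freedom `t - t' - r + r'` for testing `M'` nested within `M`
(the subtractions do not truncate for nested models). -/
def df (M' M : LMLC S) : ℕ := (M.t - M'.t) + (M'.r - M.r)

end LMLC

/-- Second derivative of `φ` at `1`. -/
def phiSecond (φ : ℝ → EReal) : ℝ := deriv (deriv fun x => (φ x).toReal) 1

/-- The class `Φ` of convex functions `φ : [0, ∞) → ℝ ∪ {∞}`, (finite and) differentiable on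
`(0, ∞)`, with `φ 1 = φ' 1 = 0` and `φ'' 1 > 0`.  Only the values on `[0, ∞)` are used. -/
structure IsPhi (φ : ℝ → EReal) : Prop where
  ne_bot : ∀ x, 0 ≤ x → φ x ≠ ⊥
  ne_top : ∀ x, 0 < x → φ x ≠ ⊤
  convex : ∀ x y a b : ℝ, 0 ≤ x → 0 ≤ y → 0 ≤ a → 0 ≤ b → a + b = 1 →
    φ (a * x + b * y) ≤ (a : EReal) * φ x + (b : EReal) * φ y
  diff : DifferentiableOn ℝ (fun x => (φ x).toReal) (Set.Ioi 0)
  one : φ 1 = 0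
  deriv_one : deriv (fun x => (φ x).toReal) 1 = 0
  second_pos : 0 < phiSecond φ

/-- The `φ`-divergence `D_φ(a, b) = ∑ b_i φ(a_i / b_i)` between nonnegative vectors, with the
conventions `0 φ(0/0) = 0` and `0 φ(p/0) = p lim_{u → ∞} φ(u)/u`. -/
def phiDiv {k : ℕ} (φ : ℝ → EReal) (a b : Fin k → ℝ) : EReal :=
  ∑ i, if b i = 0 then (a i : EReal) * limsup (fun u : ℝ => φ u / (u : EReal)) atTop
    else (b i : EReal) * φ (a i / b i)

/-- A table of counts as a real vector. -/
def tableVec {k : ℕ} (n : Fin k → ℕ) : Fin k → ℝ := fun i => n i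

/-- `θ` minimizes `D_φ(n, m(θ))` over the parameter space of the model. -/
def IsMinPhiDiv {k : ℕ} {S : SamplingPlan k} (M : LMLC S) (φ : ℝ → EReal) (N : ℝ)
    (n : Fin k → ℕ) (θ : Fin M.t → ℝ) : Prop :=
  θ ∈ M.paramSpace N (tableVec n) ∧
  IsMinOn (fun θ' => phiDiv φ (tableVec n) (M.mean θ')) (M.paramSpace N (tableVec n)) θ

/-- `est` is a minimum `φ`-divergence estimator: it returns a minimizer for every table that
admits one (for some tables with empty cells there is none; there `est` is arbitrary). -/
def IsMinPhiEstimator {k : ℕ} {S : SamplingPlan k} (M : LMLC S) (φ : ℝ → EReal) (N : ℝ)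
    (est : (Fin k → ℕ) → Fin M.t → ℝ) : Prop :=
  ∀ n, (∃ θ, IsMinPhiDiv M φ N n θ) → IsMinPhiDiv M φ N n (est n)

/-- The statistic `T^φ(θ'|θ) = (2 / φ''(1)) D_φ(m(θ), m(θ'))`, for testing `M'` within `M`. -/
def statT {k : ℕ} {S : SamplingPlan k} (M' M : LMLC S) (φ : ℝ → EReal)
    (θ' : Fin M'.t → ℝ) (θ : Fin M.t → ℝ) : EReal :=
  ((2 / phiSecond φ : ℝ) : EReal) * phiDiv φ (M.mean θ) (M'.mean θ')

/-- The statistic `S^φ(θ'|θ) = (2 / φ''(1)) (D_φ(n, m(θ')) - D_φ(n, m(θ)))`. -/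
def statS {k : ℕ} {S : SamplingPlan k} (M' M : LMLC S) (φ : ℝ → EReal) (n : Fin k → ℕ)
    (θ' : Fin M'.t → ℝ) (θ : Fin M.t → ℝ) : EReal :=
  ((2 / phiSecond φ : ℝ) : EReal) *
    (phiDiv φ (tableVec n) (M'.mean θ') - phiDiv φ (tableVec n) (M.mean θ))

/-- The chi-square distribution with `d` degrees of freedom. -/
def chiSq (d : ℕ) : Measure ℝ :=
  (Measure.pi fun _ : Fin d => gaussianReal 0 1).map fun z => ∑ i, z i ^ 2

/-- The `q`-th quantile of the chi-square distribution with `d` degrees of freedom. -/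
def chiSqQuantile (d : ℕ) (q : ℝ) : ℝ := sInf {x : ℝ | q ≤ (chiSq d).real (Set.Iic x)}

/-- Cutpoint of the test of `M'` within `M` in a sequence of `B - 1` tests: the
`(1 - α)^(1/(B-1))`-quantile of the chi-square distribution. -/
def cutpoint {k : ℕ} {S : SamplingPlan k} (M' M : LMLC S) (B : ℕ) (α : ℝ) : ℝ :=
  chiSqQuantile (LMLC.df M' M) ((1 - α) ^ (1 / ((B : ℝ) - 1)))

end

/-! Fix p and describe a positive vector m' by its local coordinates u = (m' - N p) / √(N p), taken
cell by cell. With s = √p and t = 1/√N this means m' / (N p) = 1 + t u / s, and the true mean sits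
at u = 0. A model through the true mean becomes a slightly curved set (`localModel`) with tangent
space W_b = A_b ∩ B_b^⊥, where A_b and B_b are √p times the column spaces of X_b and L_b. Regularity
at p says B_b ∩ A_b^⊥ = 0; this transversality lets the implicit function theorem approximate every
bounded tangent vector by points of the model (`exists_localModel_approx`).

On bounded sets, N times the divergence is (φ''(1)/2) ‖x - y‖² + o(1) for every φ in the class
(`IsRealPhi.tendsto_localDiv`). Convexity makes divergence minimizers bounded in local coordinates,
so they are asymptotically the orthogonal projection of the table y onto W_b, whatever φ₂ is
(`IsRealPhi.tendsto_sub_of_isMinOn`). Consequently T_b and S_b both equal ‖P_{W_b} y - P_{W_{b+1}}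
y‖² + o(1) (`statT_approx`, `statS_approx`). This part is deterministic: it is uniform over tables
with bounded local coordinates and the prescribed totals (`eventually_forall_of_approx`).

The central limit theorem (`SamplingPlan.tendsto_charFun`) gives the limit law of y: a standard
Gaussian vector projected onto the space V orthogonal to the sampling constraints. Every W_b lies in
V and the W_b decrease, so the spaces U_b = W_b ∩ W_{b+1}^⊥ are mutually orthogonal, of dimension
df_b. The limits of the statistics are therefore independent chi-squares
(`stdGaussian_real_forall_normSq_le`), and the probability that no test rejects tends to the product
of B - 1 factors (1 - α)^(1/(B-1)), which is 1 - α. A single test is a chain of length one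
(`tendsto_rejection_probability`). -/

/-! ### Divergence functions near `1` -/

/-- A real-valued divergence generator: the finite part of a function of the class `Φ`. -/
structure IsRealPhi (ψ : ℝ → ℝ) (σ : ℝ) : Prop where
  convexOn : ConvexOn ℝ (Set.Ioi 0) ψ
  diff : DifferentiableOn ℝ ψ (Set.Ioi 0)
  one : ψ 1 = 0
  deriv_one : deriv ψ 1 = 0
  second : HasDerivAt (deriv ψ) σ 1
  pos : 0 < σ

theorem IsPhi.coe_toReal {φ : ℝ → EReal} (h : IsPhi φ) {x : ℝ} (hx : 0 < x) :
    ((φ x).toReal : EReal) = φ x :=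
  EReal.coe_toReal (h.ne_top x hx) (h.ne_bot x hx.le)

theorem IsPhi.isRealPhi {φ : ℝ → EReal} (h : IsPhi φ) :
    IsRealPhi (fun x => (φ x).toReal) (phiSecond φ) where
  convexOn := by
    refine ⟨convex_Ioi 0, fun x hx y hy a b ha hb hab => ?_⟩
    have hxy : 0 < a * x + b * y := (convex_Ioi (0 : ℝ)) hx hy ha hb hab
    have := h.convex x y a b (le_of_lt hx) (le_of_lt hy) ha hb hab
    rw [← h.coe_toReal hxy, ← h.coe_toReal hx, ← h.coe_toReal hy] at this
    simp only [smul_eq_mul]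
    exact_mod_cast this
  diff := h.diff
  one := by simp [h.one]
  deriv_one := h.deriv_one
  second := by
    have hne : deriv (deriv fun x => (φ x).toReal) 1 ≠ 0 := h.second_pos.ne'
    exact (differentiableAt_of_deriv_ne_zero hne).hasDerivAt
  pos := h.second_pos

namespace IsRealPhi

variable {ψ : ℝ → ℝ} {σ : ℝ}

/-- The second derivative is only known to exist at 1, so the expansion comes from the mean value
inequality for ψ - σ/2 (u - 1)², whose derivative is o(v - 1). -/
theorem isLittleO (h : IsRealPhi ψ σ) :
    (fun u => ψ u - σ / 2 * (u - 1) ^ 2) =o[𝓝 1] fun u => (u - 1) ^ 2 := by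
  rw [Asymptotics.isLittleO_iff]
  intro ε hε
  have hd : (fun u => deriv ψ u - σ * (u - 1)) =o[𝓝 1] fun u => u - 1 := by
    have := h.second.isLittleO
    simpa [h.deriv_one, mul_comm] using this
  obtain ⟨δ, hδ, hball⟩ := Metric.eventually_nhds_iff_ball.1
    (((Asymptotics.isLittleO_iff.1 hd) hε).and (Ioi_mem_nhds (zero_lt_one' ℝ)))
  refine Metric.eventually_nhds_iff_ball.2 ⟨δ, hδ, fun u hu => ?_⟩
  have hu' : |u - 1| < δ := by simpa [Real.dist_eq] using hu
  have hder : ∀ v ∈ Metric.ball (1 : ℝ) δ,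
      HasDerivAt (fun u => ψ u - σ / 2 * (u - 1) ^ 2) (deriv ψ v - σ * (v - 1)) v := by
    intro v hv
    have hv0 : (0 : ℝ) < v := (hball v hv).2
    have h1 : HasDerivAt ψ (deriv ψ v) v :=
      ((h.diff v hv0).differentiableAt (Ioi_mem_nhds hv0)).hasDerivAt
    have h2 : HasDerivAt (fun u : ℝ => σ / 2 * (u - 1) ^ 2) (σ * (v - 1)) v := by
      have := (((hasDerivAt_id v).sub_const 1).pow 2).const_mul (σ / 2)
      refine this.congr_deriv ?_
      simp
      ring
    exact h1.sub h2
  have hsub : Metric.closedBall (1 : ℝ) |u - 1| ⊆ Metric.ball 1 δ :=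
    Metric.closedBall_subset_ball hu'
  have := (convex_closedBall (1 : ℝ) |u - 1|).norm_image_sub_le_of_norm_hasDerivWithin_le
    (C := ε * |u - 1|) (f := fun u => ψ u - σ / 2 * (u - 1) ^ 2)
    (f' := fun v => deriv ψ v - σ * (v - 1))
    (fun v hv => (hder v (hsub hv)).hasDerivWithinAt)
    (fun v hv => by
      have h1 := (hball v (hsub hv)).1
      have h2 : |v - 1| ≤ |u - 1| := by simpa [Real.dist_eq] using hv
      calc _ ≤ ε * ‖v - 1‖ := h1
        _ ≤ _ := by
          rw [Real.norm_eq_abs]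
          gcongr)
    (Metric.mem_closedBall_self (abs_nonneg _)) (x := 1) (y := u)
    (by simp [Real.dist_eq])
  simp only [h.one, sub_self, ne_eq, OfNat.ofNat_ne_zero, not_false_eq_true, zero_pow, mul_zero,
    sub_zero, Real.norm_eq_abs] at this
  rw [Real.norm_eq_abs, Real.norm_eq_abs, abs_pow]
  calc _ ≤ _ := this
    _ = _ := by ring

/-- Near 1 the expansion gives a quadratic bound. Farther away convexity takes over: the chord from
1 to u passes a point at distance δ from 1, where the quadratic bound applies, and this forces
linear growth beyond it. -/
theorem exists_lower (h : IsRealPhi ψ σ) : ∃ δ c : ℝ, 0 < δ ∧ δ < 1 ∧ 0 < c ∧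
    (∀ u, |u - 1| ≤ δ → c * (u - 1) ^ 2 ≤ ψ u) ∧
    (∀ u, 0 < u → δ ≤ |u - 1| → c * |u - 1| ≤ ψ u) := by
  have hσ := h.pos
  obtain ⟨δ, hδ, hball⟩ := Metric.eventually_nhds_iff_ball.1
    ((Asymptotics.isLittleO_iff.1 h.isLittleO) (show 0 < σ / 4 by positivity))
  set δ' := min (δ / 2) (1 / 2) with hδ'
  have hδ0 : 0 < δ' := by positivity
  have hδ1 : δ' ≤ 1 / 2 := min_le_right _ _
  have hq : ∀ u, |u - 1| ≤ δ' → σ / 4 * (u - 1) ^ 2 ≤ ψ u := by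
    intro u hu
    have : u ∈ Metric.ball (1 : ℝ) δ := by
      simp only [Metric.mem_ball, Real.dist_eq]
      have := min_le_left (δ / 2) (1 / 2 : ℝ)
      linarith
    have h1 := hball u this
    rw [Real.norm_eq_abs, Real.norm_eq_abs, abs_of_nonneg (sq_nonneg (u - 1))] at h1
    have := (abs_le.1 h1).1
    linarith
  refine ⟨δ', σ / 4 * δ', hδ0, by linarith, by positivity, fun u hu => ?_, fun u hu0 hu => ?_⟩
  · refine le_trans ?_ (hq u hu)
    gcongr
    nlinarith
  · have hpos : 0 < |u - 1| := by linarith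
    set lam := δ' / |u - 1| with hlam
    have hl0 : 0 ≤ lam := by positivity
    have hl1 : lam ≤ 1 := by rw [hlam, div_le_one hpos]; exact hu
    have hlm : lam * |u - 1| = δ' := by rw [hlam]; field_simp
    have hcv := h.convexOn.2 (Set.mem_Ioi.2 one_pos) (Set.mem_Ioi.2 hu0)
      (sub_nonneg.2 hl1) hl0 (by ring)
    simp only [smul_eq_mul, h.one, mul_zero, zero_add] at hcv
    have hv : (1 - lam) * 1 + lam * u - 1 = lam * (u - 1) := by ring
    have hv2 : |(1 - lam) * 1 + lam * u - 1| = δ' := by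
      rw [hv, abs_mul, abs_of_nonneg hl0, hlm]
    have h3 := hq ((1 - lam) * 1 + lam * u) hv2.le
    rw [← sq_abs, hv2] at h3
    have h4 : σ / 4 * δ' ^ 2 ≤ lam * ψ u := h3.trans hcv
    have h5 : lam * (σ / 4 * δ' * |u - 1|) ≤ lam * ψ u := by
      calc _ = σ / 4 * δ' * (lam * |u - 1|) := by ring
        _ = σ / 4 * δ' ^ 2 := by rw [hlm]; ring
        _ ≤ _ := h4
    exact le_of_mul_le_mul_left h5 (by positivity)

theorem nonneg (h : IsRealPhi ψ σ) {u : ℝ} (hu : 0 < u) : 0 ≤ ψ u := by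
  obtain ⟨δ, c, -, -, hc, h1, h2⟩ := h.exists_lower
  rcases le_total |u - 1| δ with hle | hle
  · exact le_trans (by positivity) (h1 u hle)
  · exact le_trans (by positivity) (h2 u hu hle)

/-- No upper bound on b is required, which is what makes a priori bounds on minimizers possible.
When a / b is near 1, the bound a ≤ 2 controls b and the quadratic regime applies; otherwise the
linear one does. -/
theorem exists_perspective_lower (h : IsRealPhi ψ σ) : ∃ c : ℝ, 0 < c ∧
    ∀ a b, 0 < a → a ≤ 2 → 0 < b → c * min ((a - b) ^ 2) |a - b| ≤ b * ψ (a / b) := by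
  obtain ⟨δ, c, hδ, hδ1, hc, h1, h2⟩ := h.exists_lower
  have h1δ : 0 < 1 - δ := by linarith
  refine ⟨min c (c * (1 - δ) / 2), by positivity, fun a b ha ha2 hb => ?_⟩
  have hab : a / b - 1 = (a - b) / b := by field_simp
  rcases le_total |a / b - 1| δ with hle | hle
  · have hba : b * (1 - δ) ≤ 2 := by
      have := (abs_le.1 hle).1
      have h3 : 1 - δ ≤ a / b := by linarith
      rw [le_div_iff₀ hb] at h3
      linarith
    calc _ ≤ (c * (1 - δ) / 2) * (a - b) ^ 2 := by
          gcongr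
          · exact min_le_right _ _
          · exact min_le_left _ _
      _ ≤ c * ((a - b) ^ 2 / b) := by
          rw [mul_div_assoc', le_div_iff₀ hb]
          nlinarith [mul_nonneg hc.le (sq_nonneg (a - b))]
      _ = b * (c * (a / b - 1) ^ 2) := by rw [hab]; field_simp
      _ ≤ _ := by gcongr; exact h1 _ hle
  · calc _ ≤ c * |a - b| := by
          gcongr
          · exact min_le_left _ _
          · exact min_le_right _ _
      _ = b * (c * |a / b - 1|) := by
          rw [hab, abs_div, abs_of_pos hb]; field_simp
      _ ≤ _ := by gcongr; exact h2 _ (by positivity) hle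

end IsRealPhi

/-! ### Divergences in local coordinates: quadratic expansion and coercivity -/

open Asymptotics in
theorem tendsto_zero_of_bounded_mul {α : Type*} {l : Filter α} {f g : α → ℝ}
    (hf : f =O[l] fun _ => (1 : ℝ)) (hg : Tendsto g l (𝓝 0)) :
    Tendsto (fun i => f i * g i) l (𝓝 0) := by
  have := hf.mul_isLittleO ((isLittleO_one_iff ℝ).2 hg)
  simpa using this

theorem tendsto_normSq_sub_normSq {α E : Type*} [NormedAddCommGroup E] {l : Filter α}
    {f g : α → E} (hf : f =O[l] fun _ => (1 : ℝ)) (hfg : Tendsto (fun i => f i - g i) l (𝓝 0)) :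
    Tendsto (fun i => ‖f i‖ ^ 2 - ‖g i‖ ^ 2) l (𝓝 0) := by
  have hg : g =O[l] fun _ => (1 : ℝ) := by
    have := hf.sub ((Asymptotics.isLittleO_one_iff ℝ).2 hfg).isBigO
    simpa using this
  have h1 : Tendsto (fun i => ‖f i‖ - ‖g i‖) l (𝓝 0) :=
    squeeze_zero_norm (fun i => abs_norm_sub_norm_le _ _) (by simpa using hfg.norm)
  have := tendsto_zero_of_bounded_mul (hf.norm_left.add hg.norm_left) h1
  refine this.congr fun i => ?_
  ring

/-- The divergence between the vectors `s² (1 + t x / s)` and `s² (1 + t y / s)`, in the local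
coordinates `x`, `y`. -/
noncomputable def localDiv {ι : Type*} [Fintype ι] (ψ : ℝ → ℝ) (s : ι → ℝ) (t : ℝ)
    (x y : EuclideanSpace ℝ ι) : ℝ :=
  ∑ i, s i ^ 2 * ((1 + t * (y i / s i)) * ψ ((1 + t * (x i / s i)) / (1 + t * (y i / s i))))

open Asymptotics in
theorem IsRealPhi.tendsto_perspective {ψ : ℝ → ℝ} {σ : ℝ} (h : IsRealPhi ψ σ) {α : Type*}
    {l : Filter α} {t a b : α → ℝ} (ht0 : ∀ᶠ i in l, t i ≠ 0) (ht : Tendsto t l (𝓝 0))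
    (ha : a =O[l] fun _ => (1 : ℝ)) (hb : b =O[l] fun _ => (1 : ℝ)) :
    Tendsto (fun i => (t i ^ 2)⁻¹ * ((1 + t i * b i) * ψ ((1 + t i * a i) / (1 + t i * b i)))
      - σ / 2 * (a i - b i) ^ 2) l (𝓝 0) := by
  have hta : Tendsto (fun i => 1 + t i * a i) l (𝓝 1) := by
    have := (tendsto_zero_of_bounded_mul ha ht).const_add 1
    simpa [mul_comm] using this
  have htb : Tendsto (fun i => 1 + t i * b i) l (𝓝 1) := by
    have := (tendsto_zero_of_bounded_mul hb ht).const_add 1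
    simpa [mul_comm] using this
  have hr : Tendsto (fun i => (1 + t i * a i) / (1 + t i * b i)) l (𝓝 1) := by
    have := hta.div htb one_ne_zero
    rw [div_one] at this
    exact this
  have hinv : Tendsto (fun i => (1 + t i * b i)⁻¹) l (𝓝 1) := by
    simpa using htb.inv₀ one_ne_zero
  have hpos : ∀ᶠ i in l, 0 < 1 + t i * b i := htb.eventually (lt_mem_nhds zero_lt_one)
  have hab : (fun i => (a i - b i) ^ 2) =O[l] fun _ => (1 : ℝ) := by
    simpa using (ha.sub hb).pow 2
  have hlo := h.isLittleO.comp_tendsto hr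
  have h1 : Tendsto (fun i => (t i ^ 2)⁻¹ * (1 + t i * b i) *
      (ψ ((1 + t i * a i) / (1 + t i * b i))
        - σ / 2 * ((1 + t i * a i) / (1 + t i * b i) - 1) ^ 2)) l (𝓝 0) := by
    have h2 := (isBigO_refl (fun i => (t i ^ 2)⁻¹ * (1 + t i * b i)) l).mul_isLittleO hlo
    refine (isLittleO_one_iff ℝ).1 (h2.trans_isBigO ?_)
    have h3 : (fun i => (a i - b i) ^ 2 * (1 + t i * b i)⁻¹) =O[l] fun _ => (1 : ℝ) := by
      simpa using hab.mul (hinv.isBigO_one ℝ)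
    refine (EventuallyEq.isBigO ?_).trans h3
    filter_upwards [ht0, hpos] with i hi hp
    simp only [Function.comp]
    field_simp
    ring
  -- The quadratic term alone equals σ/2 (a - b)² / (1 + t b) after rescaling; this absorbs the
  -- factor 1 / (1 + t b), which tends to 1.
  have h4 := tendsto_zero_of_bounded_mul (hab.const_mul_left (σ / 2))
    (by simpa using hinv.sub_const 1)
  have := h1.add h4
  rw [add_zero] at this
  refine this.congr' ?_
  filter_upwards [ht0, hpos] with i hi hp
  have hr1 : (1 + t i * a i) / (1 + t i * b i) - 1 = t i * (a i - b i) / (1 + t i * b i) := by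
    field_simp
    ring
  rw [hr1]
  field_simp
  ring

section LocalDiv

variable {ι α : Type*} [Fintype ι] {ψ : ℝ → ℝ} {σ : ℝ} {s : ι → ℝ} {l : Filter α} {t : α → ℝ}

open Asymptotics in
theorem EuclideanSpace.isBigO_apply {x : α → EuclideanSpace ℝ ι}
    (hx : x =O[l] fun _ => (1 : ℝ)) (i : ι) : (fun a => x a i) =O[l] fun _ => (1 : ℝ) :=
  (IsBigO.of_norm_le fun a => PiLp.norm_apply_le (x a) i).trans hx.norm_left

theorem IsRealPhi.tendsto_localDiv (h : IsRealPhi ψ σ) (hs : ∀ i, 0 < s i)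
    (ht : Tendsto t l (𝓝[>] 0)) {x y : α → EuclideanSpace ℝ ι}
    (hx : x =O[l] fun _ => (1 : ℝ)) (hy : y =O[l] fun _ => (1 : ℝ)) :
    Tendsto (fun a => (t a ^ 2)⁻¹ * localDiv ψ s (t a) (x a) (y a)
      - σ / 2 * ‖x a - y a‖ ^ 2) l (𝓝 0) := by
  have ht' : Tendsto t l (𝓝 0) := ht.mono_right nhdsWithin_le_nhds
  have ht0 : ∀ᶠ a in l, t a ≠ 0 :=
    (ht.eventually self_mem_nhdsWithin).mono fun a ha => (Set.mem_Ioi.1 ha).ne'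
  have key : ∀ i, Tendsto (fun a => s i ^ 2 * ((t a ^ 2)⁻¹ * ((1 + t a * (y a i / s i)) *
      ψ ((1 + t a * (x a i / s i)) / (1 + t a * (y a i / s i))))
      - σ / 2 * (x a i / s i - y a i / s i) ^ 2)) l (𝓝 0) := by
    intro i
    have hb : ∀ {z : α → EuclideanSpace ℝ ι}, (z =O[l] fun _ => (1 : ℝ)) →
        (fun a => z a i / s i) =O[l] fun _ => (1 : ℝ) := by
      intro z hz
      simpa [div_eq_inv_mul] using (EuclideanSpace.isBigO_apply hz i).const_mul_left (s i)⁻¹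
    simpa using (h.tendsto_perspective ht0 ht' (hb hx) (hb hy)).const_mul (s i ^ 2)
  have := tendsto_finsetSum Finset.univ fun i _ => key i
  simp only [Finset.sum_const_zero] at this
  refine this.congr fun a => ?_
  rw [localDiv, EuclideanSpace.norm_sq_eq, Finset.mul_sum, Finset.mul_sum,
    ← Finset.sum_sub_distrib]
  refine Finset.sum_congr rfl fun i _ => ?_
  have := (hs i).ne'
  simp only [PiLp.sub_apply, Real.norm_eq_abs, sq_abs]
  field_simp

/-- This replaces a consistency proof: anything at least as close to the table as the true mean,
which is at 0, is bounded in local coordinates. All terms are nonnegative, so each is at most a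
constant times t², and the lower bound on the perspective turns this into a bound on the coordinate.
-/
theorem IsRealPhi.exists_bound_of_localDiv_le (h : IsRealPhi ψ σ) (hs : ∀ i, 0 < s i)
    (ht : Tendsto t l (𝓝[>] 0)) {y : α → EuclideanSpace ℝ ι} (hy : y =O[l] fun _ => (1 : ℝ)) :
    ∃ C : ℝ, ∀ᶠ a in l, ∀ u : EuclideanSpace ℝ ι, (∀ i, 0 < 1 + t a * (u i / s i)) →
      localDiv ψ s (t a) (y a) u ≤ localDiv ψ s (t a) (y a) 0 → ‖u‖ ≤ C := by
  obtain ⟨c, hc, hlow⟩ := h.exists_perspective_lower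
  have ht' : Tendsto t l (𝓝 0) := ht.mono_right nhdsWithin_le_nhds
  have htpos : ∀ᶠ a in l, 0 < t a := ht.eventually self_mem_nhdsWithin
  have ht1 : ∀ᶠ a in l, t a < 1 := ht'.eventually (gt_mem_nhds one_pos)
  obtain ⟨K, hK⟩ := hy.bound
  have hD := h.tendsto_localDiv (x := y) (y := fun _ => 0) hs ht hy
    (Asymptotics.isBigO_const_const _ one_ne_zero _)
  have hD1 := hD.eventually (gt_mem_nhds one_pos)
  have hfin : ∀ i, ∀ᶠ a in l, 0 < 1 + t a * (y a i / s i) ∧ 1 + t a * (y a i / s i) ≤ 2 := by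
    intro i
    have hb : (fun a => y a i / s i) =O[l] fun _ => (1 : ℝ) := by
      simpa [div_eq_inv_mul] using (EuclideanSpace.isBigO_apply hy i).const_mul_left (s i)⁻¹
    have := (tendsto_zero_of_bounded_mul hb ht').const_add 1
    rw [add_zero] at this
    filter_upwards [this.eventually (lt_mem_nhds one_pos),
      this.eventually (gt_mem_nhds one_lt_two)] with a h1 h2
    rw [mul_comm] at h1 h2
    exact ⟨h1, h2.le⟩
  -- The divergence at 0 is at most t² (σ/2 ‖y‖² + 1), with ‖y‖ ≤ K.
  set D := 1 + σ / 2 * K ^ 2 with hDdef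
  have hD0 : 0 < D := by have := h.pos; positivity
  set C := fun i => s i * (1 + D / (s i ^ 2 * c)) + K with hC
  refine ⟨∑ i, |C i|, ?_⟩
  filter_upwards [htpos, ht1, hK, hD1, eventually_all.2 hfin] with a ht0 ht1 hK hD1 hfin u hu hle
  have hKa : ‖y a‖ ≤ K := by simpa using hK
  have hD0' : localDiv ψ s (t a) (y a) 0 ≤ D * t a ^ 2 := by
    have h1 : (t a ^ 2)⁻¹ * localDiv ψ s (t a) (y a) 0 ≤ D := by
      have h2 : ‖y a‖ ^ 2 ≤ K ^ 2 := by gcongr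
      have h3 : σ / 2 * ‖y a‖ ^ 2 ≤ σ / 2 * K ^ 2 := by have := h.pos; gcongr
      simp only [sub_zero] at hD1
      linarith
    rwa [inv_mul_le_iff₀ (by positivity), mul_comm] at h1
  have hcoord : ∀ i, |u i| ≤ |C i| := by
    intro i
    have hsi := hs i
    set A := 1 + t a * (y a i / s i)
    set U := 1 + t a * (u i / s i)
    have hterm : s i ^ 2 * (U * ψ (A / U)) ≤ D * t a ^ 2 := by
      refine le_trans ?_ (hle.trans hD0')
      refine Finset.single_le_sum (f := fun i => s i ^ 2 * ((1 + t a * (u i / s i)) *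
        ψ ((1 + t a * (y a i / s i)) / (1 + t a * (u i / s i))))) (fun j _ => ?_)
        (Finset.mem_univ i)
      exact mul_nonneg (sq_nonneg _) (mul_nonneg (hu j).le (h.nonneg (div_pos (hfin j).1 (hu j))))
    have h1 := hlow A U (hfin i).1 (hfin i).2 (hu i)
    set R := D / (s i ^ 2 * c) with hR
    have hR0 : 0 < R := by positivity
    have hm : min ((A - U) ^ 2) |A - U| ≤ R * t a ^ 2 := by
      have : s i ^ 2 * (c * min ((A - U) ^ 2) |A - U|) ≤ D * t a ^ 2 :=
        (mul_le_mul_of_nonneg_left h1 (sq_nonneg _)).trans hterm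
      rw [hR, div_mul_eq_mul_div, le_div_iff₀ (by positivity)]
      linarith
    -- The constant 1 + R serves both regimes: √R ≤ 1 + R in the quadratic one, and R t² ≤ (1 + R) t
    -- in the linear one because t < 1.
    have hAU : |A - U| ≤ (1 + R) * t a := by
      rcases min_le_iff.1 hm with h2 | h2
      · refine abs_le_of_sq_le_sq (h2.trans ?_) (by positivity)
        rw [mul_pow]
        gcongr
        nlinarith
      · refine h2.trans ?_
        nlinarith [mul_pos hR0 ht0]
    have hAU2 : A - U = t a * ((y a i - u i) / s i) := by simp only [A, U]; ring
    rw [hAU2, abs_mul, abs_of_pos ht0, abs_div, abs_of_pos hsi, mul_comm] at hAU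
    have h3 := le_of_mul_le_mul_right hAU ht0
    rw [div_le_iff₀ hsi] at h3
    have h4 : |y a i| ≤ K := (PiLp.norm_apply_le (y a) i).trans hKa
    have h5 : |u i| ≤ |y a i - u i| + |y a i| := by
      have := abs_sub_abs_le_abs_sub (u i) (y a i)
      rw [abs_sub_comm] at this
      linarith
    refine le_trans ?_ (le_abs_self _)
    simp only [hC]
    linarith
  refine (EuclideanSpace.norm_eq u).le.trans ?_
  calc √(∑ i, ‖u i‖ ^ 2) ≤ ∑ i, ‖u i‖ := by
        refine Real.sqrt_le_iff.2 ⟨by positivity, ?_⟩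
        exact Finset.sum_sq_le_sq_sum_of_nonneg fun i _ => norm_nonneg _
    _ ≤ _ := Finset.sum_le_sum fun i _ => hcoord i

end LocalDiv

/-! ### Local models and their tangent spaces -/

open Asymptotics in
/-- The kernel of a surjective strict derivative is tangent to the level set. -/
theorem HasStrictFDerivAt.exists_zero_approx {V F α : Type*} [NormedAddCommGroup V]
    [NormedSpace ℝ V] [CompleteSpace V] [NormedAddCommGroup F] [NormedSpace ℝ F]
    [FiniteDimensional ℝ F] {f : V → F} {f' : V →L[ℝ] F} (hf : HasStrictFDerivAt f f' 0)
    (hsurj : f'.range = ⊤) (hf0 : f 0 = 0) {l : Filter α} {κ : α → V} (hκ : Tendsto κ l (𝓝 0))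
    (hker : ∀ a, f' (κ a) = 0) :
    ∃ v : α → V, (∀ᶠ a in l, f (v a) = 0) ∧ (fun a => v a - κ a) =o[l] κ := by
  -- The implicit function parametrizes the zero set by the kernel of f', and its derivative at 0 is
  -- the inclusion of the kernel.
  set g := hf.implicitFunction f f' hsurj (f 0) with hg
  set k : α → f'.ker := fun a => ⟨κ a, hker a⟩ with hk
  have hk0 : Tendsto k l (𝓝 0) := tendsto_subtype_rng.2 hκ
  refine ⟨fun a => g (k a), ?_, ?_⟩
  · have h1 := hf.map_implicitFunction_eq hsurj
    rw [nhds_prod_eq] at h1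
    have h2 : Tendsto (fun a => (f 0, k a)) l (𝓝 (f 0) ×ˢ 𝓝 0) :=
      tendsto_const_nhds.prodMk hk0
    filter_upwards [h2.eventually h1] with a ha
    exact ha.trans hf0
  · have h1 := (hf.to_implicitFunction hsurj).hasFDerivAt.isLittleO
    simp only [HasStrictFDerivAt.implicitFunction_apply_image, sub_zero] at h1
    exact (h1.comp_tendsto hk0).trans_isBigO (isBigO_of_le l fun a => le_rfl)

theorem EuclideanSpace.tendsto_of_apply {ι α : Type*} {l : Filter α}
    {x : α → EuclideanSpace ℝ ι} {z : EuclideanSpace ℝ ι}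
    (h : ∀ i, Tendsto (fun a => x a i) l (𝓝 (z i))) : Tendsto x l (𝓝 z) :=
  ((PiLp.continuous_toLp 2 _).tendsto _).comp (tendsto_pi_nhds.2 h)

section LocalModel

variable {ι : Type*} [Fintype ι]

/-- A loglinear model with linear constraints in local coordinates: the vectors `u`, orthogonal to
`B`, such that `log (1 + t u / s) = ζ / s` for some `ζ` in `A`. -/
def localModel (s : ι → ℝ) (A B : Submodule ℝ (EuclideanSpace ℝ ι)) (t : ℝ) :
    Set (EuclideanSpace ℝ ι) :=
  {u | u ∈ Bᗮ ∧ ∃ ζ ∈ A, ∀ i, 1 + t * (u i / s i) = Real.exp (ζ i / s i)}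

variable {α : Type*} {s : ι → ℝ} {A B : Submodule ℝ (EuclideanSpace ℝ ι)} {l : Filter α}
  {t : α → ℝ}

theorem localModel_pos {τ : ℝ} {u : EuclideanSpace ℝ ι} (hu : u ∈ localModel s A B τ) (i : ι) :
    0 < 1 + τ * (u i / s i) := by
  obtain ⟨-, ζ, -, hζ⟩ := hu
  rw [hζ i]
  exact Real.exp_pos _

theorem zero_mem_localModel (τ : ℝ) : (0 : EuclideanSpace ℝ ι) ∈ localModel s A B τ :=
  ⟨zero_mem _, 0, zero_mem _, fun i => by simp⟩

open Asymptotics in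
theorem tendsto_inv_mul_log_sub {x τ : α → ℝ} (hτ0 : ∀ᶠ a in l, τ a ≠ 0)
    (hτ : Tendsto τ l (𝓝 0)) (hx : x =O[l] fun _ => (1 : ℝ)) :
    Tendsto (fun a => (τ a)⁻¹ * Real.log (1 + τ a * x a) - x a) l (𝓝 0) := by
  have h1 : (fun z => Real.log (1 + z) - z) =o[𝓝 0] fun z => z := by
    have hd : HasDerivAt (fun z : ℝ => Real.log (1 + z)) 1 0 := by
      have := ((hasDerivAt_id (0 : ℝ)).const_add 1).log (by simp)
      simpa using this
    simpa using hd.isLittleO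
  have hz : Tendsto (fun a => τ a * x a) l (𝓝 0) := by
    simpa [mul_comm] using tendsto_zero_of_bounded_mul hx hτ
  have h2 := (isBigO_refl (fun a => (τ a)⁻¹) l).mul_isLittleO (h1.comp_tendsto hz)
  refine (isLittleO_one_iff ℝ).1 ((h2.congr' ?_ EventuallyEq.rfl).trans_isBigO
    ((EventuallyEq.isBigO ?_).trans hx))
  · filter_upwards [hτ0] with a ha
    simp only [Function.comp]
    field_simp
  · filter_upwards [hτ0] with a ha
    simp only [Function.comp]
    field_simp

theorem orthogonal_inf_orthogonal (A B : Submodule ℝ (EuclideanSpace ℝ ι)) :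
    (A ⊓ Bᗮ)ᗮ = Aᗮ ⊔ B := by
  rw [← Submodule.orthogonal_orthogonal (Aᗮ ⊔ B), ← Submodule.inf_orthogonal,
    Submodule.orthogonal_orthogonal]

open Asymptotics in
-- Half of the tangency, with no regularity needed: since log(1 + t u / s) / t is u / s + o(1), a
-- bounded u in the model is asymptotically in A, and it is exactly orthogonal to B. Pairing with (A
-- ∩ B^⊥)^⊥ = A^⊥ + B then shows that the normal part vanishes.
theorem tendsto_sub_starProjection_of_localModel (hs : ∀ i, 0 < s i)
    (ht : Tendsto t l (𝓝[>] 0)) {u : α → EuclideanSpace ℝ ι} (hu : u =O[l] fun _ => (1 : ℝ))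
    (hmem : ∀ᶠ a in l, u a ∈ localModel s A B (t a)) :
    Tendsto (fun a => u a - (A ⊓ Bᗮ).starProjection (u a)) l (𝓝 0) := by
  have ht' : Tendsto t l (𝓝 0) := ht.mono_right nhdsWithin_le_nhds
  have htpos : ∀ᶠ a in l, 0 < t a := ht.eventually self_mem_nhdsWithin
  set ζ : α → EuclideanSpace ℝ ι :=
    fun a => WithLp.toLp 2 fun i => s i * ((t a)⁻¹ * Real.log (1 + t a * (u a i / s i))) with hζ
  have hζA : ∀ᶠ a in l, ζ a ∈ A := by
    filter_upwards [hmem] with a ha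
    obtain ⟨-, z, hz, hzu⟩ := ha
    have : ζ a = (t a)⁻¹ • z := by
      ext i
      have := (hs i).ne'
      simp only [hζ, hzu i, Real.log_exp, PiLp.smul_apply, smul_eq_mul]
      field_simp
    rw [this]
    exact A.smul_mem _ hz
  have hζu : Tendsto (fun a => ζ a - u a) l (𝓝 0) := by
    refine EuclideanSpace.tendsto_of_apply fun i => ?_
    have hb : (fun a => u a i / s i) =O[l] fun _ => (1 : ℝ) := by
      simpa [div_eq_inv_mul] using (EuclideanSpace.isBigO_apply hu i).const_mul_left (s i)⁻¹
    have := (tendsto_inv_mul_log_sub (htpos.mono fun a h => h.ne') ht' hb).const_mul (s i)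
    simp only [mul_zero] at this
    refine this.congr fun a => ?_
    have := (hs i).ne'
    simp only [hζ, PiLp.sub_apply]
    field_simp
  have hA : ∀ e ∈ Aᗮ, Tendsto (fun a => inner ℝ e (u a)) l (𝓝 0) := by
    intro e he
    have h1 : Tendsto (fun a => -inner ℝ e (ζ a - u a)) l (𝓝 0) := by
      simpa using ((tendsto_const_nhds (x := e)).inner (𝕜 := ℝ) hζu).neg
    refine h1.congr' ?_
    filter_upwards [hζA] with a ha
    rw [inner_sub_right, Submodule.inner_left_of_mem_orthogonal ha he]
    ring
  have hB : ∀ e ∈ B, Tendsto (fun a => inner ℝ e (u a)) l (𝓝 0) := by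
    intro e he
    refine tendsto_const_nhds.congr' ?_
    filter_upwards [hmem] with a ha
    exact (Submodule.inner_right_of_mem_orthogonal he ha.1).symm
  have hW : ∀ e ∈ (A ⊓ Bᗮ)ᗮ, Tendsto (fun a => inner ℝ e (u a)) l (𝓝 0) := by
    intro e he
    rw [orthogonal_inf_orthogonal] at he
    obtain ⟨e₁, h₁, e₂, h₂, rfl⟩ := Submodule.mem_sup.1 he
    simpa [inner_add_left] using (hA e₁ h₁).add (hB e₂ h₂)
  classical
  refine EuclideanSpace.tendsto_of_apply fun i => ?_
  set e : EuclideanSpace ℝ ι := EuclideanSpace.single i 1 with he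
  refine (hW _ (Submodule.sub_starProjection_mem_orthogonal (K := A ⊓ Bᗮ) e)).congr fun a => ?_
  have : ∀ v : EuclideanSpace ℝ ι, inner ℝ e v = v i := fun v => by
    simp [he, EuclideanSpace.inner_single_left]
  rw [inner_sub_left, Submodule.inner_starProjection_left_eq_right, ← inner_sub_right, this]

/-- The chart `η ↦ s (exp (η / s) - 1)`. -/
noncomputable def expChart (s : ι → ℝ) (η : EuclideanSpace ℝ ι) : EuclideanSpace ℝ ι :=
  WithLp.toLp 2 fun i => s i * (Real.exp (η i / s i) - 1)

theorem hasStrictFDerivAt_expChart (hs : ∀ i, 0 < s i) :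
    HasStrictFDerivAt (expChart s) (ContinuousLinearMap.id ℝ (EuclideanSpace ℝ ι)) 0 := by
  rw [hasStrictFDerivAt_euclidean]
  intro i
  have h1 : HasStrictFDerivAt (fun η : EuclideanSpace ℝ ι => η i)
      (EuclideanSpace.proj i : EuclideanSpace ℝ ι →L[ℝ] ℝ) 0 :=
    (EuclideanSpace.proj i : EuclideanSpace ℝ ι →L[ℝ] ℝ).hasStrictFDerivAt
  have h2 : HasStrictDerivAt (fun x : ℝ => s i * (Real.exp (x / s i) - 1)) 1
      ((0 : EuclideanSpace ℝ ι) i) := by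
    have h : HasStrictDerivAt (fun x : ℝ => Real.exp (x / s i) - 1)
        (Real.exp (0 / s i) * (1 / s i)) 0 :=
      (((hasStrictDerivAt_id (0 : ℝ)).div_const (s i)).exp).sub_const 1
    refine (h.const_mul (s i)).congr_deriv ?_
    have := (hs i).ne'
    simp only [zero_div, Real.exp_zero]
    field_simp
  have h3 := h2.comp_hasStrictFDerivAt (0 : EuclideanSpace ℝ ι) h1
  refine h3.congr_fderiv ?_
  ext v
  simp

/-- A vector of B orthogonal to the projection of A onto B is orthogonal to A itself. -/
theorem surjective_orthogonalProjectionOnto_comp (hreg : B ⊓ Aᗮ = ⊥) :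
    (B.orthogonalProjectionOnto ∘L A.subtypeL).range = ⊤ := by
  rw [← Submodule.orthogonal_eq_bot_iff, Submodule.eq_bot_iff]
  intro b hb
  have hbA : (b : EuclideanSpace ℝ ι) ∈ Aᗮ := by
    rw [Submodule.mem_orthogonal]
    intro a ha
    have := (Submodule.mem_orthogonal _ b).1 hb _ ⟨⟨a, ha⟩, rfl⟩
    simpa using this
  have : (b : EuclideanSpace ℝ ι) ∈ B ⊓ Aᗮ := ⟨b.2, hbA⟩
  rw [hreg, Submodule.mem_bot] at this
  exact Subtype.ext this

open Asymptotics in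
-- The converse half of the tangency. On A, the model is the zero set of η ↦ P_B (`expChart s η`),
-- whose derivative at 0 is P_B restricted to A: it is surjective by transversality and has kernel A
-- ∩ B^⊥. The small kernel vectors t w are corrected to zeros with error o(t), then rescaled by 1/t.
theorem exists_localModel_approx (hs : ∀ i, 0 < s i) (hreg : B ⊓ Aᗮ = ⊥)
    (ht : Tendsto t l (𝓝[>] 0)) {w : α → EuclideanSpace ℝ ι} (hw : w =O[l] fun _ => (1 : ℝ))
    (hmem : ∀ a, w a ∈ A ⊓ Bᗮ) :
    ∃ u : α → EuclideanSpace ℝ ι, (∀ᶠ a in l, u a ∈ localModel s A B (t a)) ∧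
      Tendsto (fun a => u a - w a) l (𝓝 0) := by
  have ht' : Tendsto t l (𝓝 0) := ht.mono_right nhdsWithin_le_nhds
  have htpos : ∀ᶠ a in l, 0 < t a := ht.eventually self_mem_nhdsWithin
  set F : A → B := fun η => B.orthogonalProjectionOnto (expChart s η) with hF
  have hF' : HasStrictFDerivAt F (B.orthogonalProjectionOnto ∘L A.subtypeL) 0 := by
    have h1 : HasStrictFDerivAt (fun η : A => expChart s (η : EuclideanSpace ℝ ι))
        (ContinuousLinearMap.id ℝ _ ∘L A.subtypeL) 0 :=
      (hasStrictFDerivAt_expChart hs).comp (0 : A) A.subtypeL.hasStrictFDerivAt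
    exact (B.orthogonalProjectionOnto.hasStrictFDerivAt).comp (0 : A) h1
  have hsurj := surjective_orthogonalProjectionOnto_comp hreg
  have hF0 : F 0 = 0 := by
    have : expChart s (0 : EuclideanSpace ℝ ι) = 0 := by ext i; simp [expChart]
    simp [hF, this]
  set κ : α → A := fun a => t a • ⟨w a, (hmem a).1⟩ with hκ
  have hker : ∀ a, (B.orthogonalProjectionOnto ∘L A.subtypeL) (κ a) = 0 := by
    intro a
    have : B.starProjection (w a) = 0 :=
      (Submodule.starProjection_apply_eq_zero_iff B).2 (hmem a).2
    exact Subtype.ext (by simp [hκ, this])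
  have hκn : ∀ a, ‖κ a‖ = ‖t a * ‖w a‖‖ := fun a => by
    simp [hκ, norm_smul]
  have hκ0 : Tendsto κ l (𝓝 0) := by
    rw [tendsto_zero_iff_norm_tendsto_zero]
    simp only [hκn]
    have := tendsto_zero_of_bounded_mul hw.norm_left ht'
    simpa [mul_comm] using this.norm
  obtain ⟨v, hv, hvκ⟩ := hF'.exists_zero_approx hsurj hF0 hκ0 hker
  have hχ : (fun η => expChart s η - η) =o[𝓝 0] fun η => η := by
    have h1 := (hasStrictFDerivAt_expChart hs).hasFDerivAt.isLittleO
    have : expChart s (0 : EuclideanSpace ℝ ι) = 0 := by ext i; simp [expChart]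
    simpa [this] using h1
  have hvO : v =O[l] κ := by simpa using hvκ.isBigO.add (isBigO_refl κ l)
  have hvO' : (fun a => (v a : EuclideanSpace ℝ ι)) =O[l] κ := 
    (isBigO_of_le l fun a => le_rfl :
      (fun a => (v a : EuclideanSpace ℝ ι)) =O[l] v).trans hvO
  have hv0 : Tendsto (fun a => (v a : EuclideanSpace ℝ ι)) l (𝓝 0) := hvO'.trans_tendsto hκ0
  have hvκ' : (fun a => (v a : EuclideanSpace ℝ ι) - κ a) =o[l] κ := 
    (isBigO_of_le l fun a => le_rfl : (fun a => (v a : EuclideanSpace ℝ ι) - κ a) =O[l]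
      fun a => v a - κ a).trans_isLittleO hvκ
  have htot : (fun a => expChart s (v a) - (κ a)) =o[l] t := by
    have h1 := ((hχ.comp_tendsto hv0).trans_isBigO hvO').add hvκ'
    have h2 : κ =O[l] t := by
      have : (fun a => t a * ‖w a‖) =O[l] t := by
        simpa using (isBigO_refl t l).mul hw.norm_left
      refine (isBigO_of_le _ fun a => ?_).trans this
      exact (hκn a).le
    simpa using h1.trans_isBigO h2
  refine ⟨fun a => (t a)⁻¹ • expChart s (v a), ?_, ?_⟩
  · filter_upwards [htpos, hv] with a hta hFa
    refine ⟨Submodule.smul_mem _ _ ?_, v a, (v a).2, fun i => ?_⟩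
    · rw [← Submodule.starProjection_apply_eq_zero_iff]
      exact congrArg Subtype.val hFa
    · have := (hs i).ne'
      simp only [expChart, PiLp.smul_apply, smul_eq_mul]
      field_simp
      ring
  · have h1 := (isBigO_refl (fun a => (t a)⁻¹) l).smul_isLittleO htot
    refine (isLittleO_one_iff ℝ).1 ((h1.congr' ?_ ?_).of_norm_right)
    · filter_upwards [htpos] with a hta
      simp only [smul_sub, hκ, Submodule.coe_smul, smul_smul, inv_mul_cancel₀ hta.ne', one_smul]
    · filter_upwards [htpos] with a hta
      simp [hta.ne']

end LocalModel

/-! ### Existence of minimum divergence estimates and their asymptotic projection -/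

section MinimumDivergence

variable {ι α : Type*} [Fintype ι] {s : ι → ℝ} {A B : Submodule ℝ (EuclideanSpace ℝ ι)}
  {l : Filter α} {t : α → ℝ} {ψ : ℝ → ℝ} {σ : ℝ}

/-- Eliminating ζ by the logarithm turns membership into a closed condition on u, as compactness
requires. -/
theorem mem_localModel_iff (hs : ∀ i, 0 < s i) {τ : ℝ} {u : EuclideanSpace ℝ ι}
    (hu : ∀ i, 0 < 1 + τ * (u i / s i)) :
    u ∈ localModel s A B τ ↔ u ∈ Bᗮ ∧
      (WithLp.toLp 2 fun i => s i * Real.log (1 + τ * (u i / s i)) : EuclideanSpace ℝ ι) ∈ A := by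
  refine and_congr_right fun _ => ⟨fun ⟨ζ, hζ, h⟩ => ?_, fun h => ⟨_, h, fun i => ?_⟩⟩
  · convert! hζ using 1
    ext i
    have := (hs i).ne'
    simp only [h i, Real.log_exp]
    field_simp
  · have := (hs i).ne'
    simp only
    rw [mul_div_cancel_left₀ _ this, Real.exp_log (hu i)]

theorem IsRealPhi.continuousOn_localDiv (h : IsRealPhi ψ σ) {τ : ℝ} {y : EuclideanSpace ℝ ι}
    (hy : ∀ i, 0 < 1 + τ * (y i / s i)) :
    ContinuousOn (localDiv ψ s τ y) {u | ∀ i, 0 < 1 + τ * (u i / s i)} := by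
  have hc : ∀ i, Continuous fun u : EuclideanSpace ℝ ι => 1 + τ * (u i / s i) := fun i => by
    fun_prop
  refine continuousOn_finsetSum _ fun i _ => ?_
  refine continuousOn_const.mul ((hc i).continuousOn.mul ?_)
  refine h.diff.continuousOn.comp
    (continuousOn_const.div (hc i).continuousOn fun u hu => (hu i).ne') fun u hu => ?_
  exact div_pos (hy i) (hu i)

theorem eventually_one_add_pos (hs : ∀ i, 0 < s i) (ht : Tendsto t l (𝓝 0)) (C : ℝ) :
    ∀ᶠ a in l, ∀ u : EuclideanSpace ℝ ι, ‖u‖ ≤ C → ∀ i, 0 < 1 + t a * (u i / s i) := by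
  have h1 : ∀ i, ∀ᶠ a in l, |t a| * (C / s i) < 1 := by
    intro i
    have := (ht.abs).mul_const (C / s i)
    simp only [abs_zero, zero_mul] at this
    exact this.eventually (gt_mem_nhds one_pos)
  filter_upwards [eventually_all.2 h1] with a ha u hu i
  have h2 : |t a * (u i / s i)| < 1 := by
    rw [abs_mul, abs_div, abs_of_pos (hs i)]
    refine lt_of_le_of_lt ?_ (ha i)
    have := hs i
    gcongr
    exact (PiLp.norm_apply_le u i).trans hu
  have := (abs_lt.1 h2).1
  linarith

/-- A minimum divergence estimate exists eventually. -/
theorem IsRealPhi.eventually_exists_isMinOn (h : IsRealPhi ψ σ) (hs : ∀ i, 0 < s i)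
    (ht : Tendsto t l (𝓝[>] 0)) {y : α → EuclideanSpace ℝ ι} (hy : y =O[l] fun _ => (1 : ℝ)) :
    ∀ᶠ a in l, ∃ u ∈ localModel s A B (t a),
      IsMinOn (localDiv ψ s (t a) (y a)) (localModel s A B (t a)) u := by
  have ht' : Tendsto t l (𝓝 0) := ht.mono_right nhdsWithin_le_nhds
  obtain ⟨C, hC⟩ := h.exists_bound_of_localDiv_le hs ht hy
  obtain ⟨K, hK⟩ := hy.bound
  filter_upwards [hC, hK, eventually_one_add_pos hs ht' C, eventually_one_add_pos hs ht' K]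
    with a hC hK hposC hposK
  have hyK : ‖y a‖ ≤ K := by simpa using hK
  set τ := t a
  -- On the ball all the arguments of the logarithm are positive, so the model is closed there.
  -- Model points outside the ball do no better than 0, so minimizing over this compact piece is
  -- enough.
  have hclosed : IsClosed (localModel s A B τ ∩ Metric.closedBall 0 C) := by
    have h1 : ContinuousOn (fun u : EuclideanSpace ℝ ι =>
        (WithLp.toLp 2 fun i => s i * Real.log (1 + τ * (u i / s i)) : EuclideanSpace ℝ ι))
        (Metric.closedBall 0 C) := by
      refine (PiLp.continuous_toLp 2 _).comp_continuousOn (continuousOn_pi.2 fun i => ?_)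
      refine continuousOn_const.mul (ContinuousOn.log (by fun_prop) fun u hu => ?_)
      exact (hposC u (by simpa using hu) i).ne'
    have h2 := h1.preimage_isClosed_of_isClosed Metric.isClosed_closedBall
      A.closed_of_finiteDimensional
    convert! h2.inter (Submodule.isClosed_orthogonal B) using 1
    ext u
    simp only [Set.mem_inter_iff, Set.mem_preimage, SetLike.mem_coe]
    constructor
    · rintro ⟨hu, hb⟩
      rw [mem_localModel_iff hs (hposC u (by simpa using hb))] at hu
      exact ⟨⟨hb, hu.2⟩, hu.1⟩
    · rintro ⟨⟨hb, hA⟩, hB⟩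
      exact ⟨(mem_localModel_iff hs (hposC u (by simpa using hb))).2 ⟨hB, hA⟩, hb⟩
  have hcomp : IsCompact (localModel s A B τ ∩ Metric.closedBall 0 C) :=
    (isCompact_closedBall _ _).of_isClosed_subset hclosed Set.inter_subset_right
  have hcont : ContinuousOn (localDiv ψ s τ (y a)) (localModel s A B τ ∩ Metric.closedBall 0 C) :=
    (h.continuousOn_localDiv (hposK _ hyK)).mono fun u hu i => localModel_pos hu.1 i
  have h0C : ‖(0 : EuclideanSpace ℝ ι)‖ ≤ C := hC 0 (fun i => by simp) le_rfl
  have h0 : (0 : EuclideanSpace ℝ ι) ∈ localModel s A B τ ∩ Metric.closedBall 0 C :=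
    ⟨zero_mem_localModel τ, by simpa using h0C⟩
  obtain ⟨u, hu, hmin⟩ := hcomp.exists_isMinOn ⟨0, h0⟩ hcont
  refine ⟨u, hu.1, fun v hv => ?_⟩
  rcases le_total (localDiv ψ s τ (y a) v) (localDiv ψ s τ (y a) 0) with hle | hle
  · exact hmin ⟨hv, by simpa using hC v (localModel_pos hv) hle⟩
  · exact (hmin h0).trans hle

open Asymptotics in
/-- The local coordinates of minimum divergence estimates are asymptotically the orthogonal
projections onto the tangent space of the model. -/
theorem IsRealPhi.tendsto_sub_of_isMinOn (h : IsRealPhi ψ σ) (hs : ∀ i, 0 < s i)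
    (hreg : B ⊓ Aᗮ = ⊥) (ht : Tendsto t l (𝓝[>] 0)) {y u : α → EuclideanSpace ℝ ι}
    (hy : y =O[l] fun _ => (1 : ℝ)) (hu : ∀ᶠ a in l, u a ∈ localModel s A B (t a))
    (hmin : ∀ᶠ a in l, IsMinOn (localDiv ψ s (t a) (y a)) (localModel s A B (t a)) (u a)) :
    (u =O[l] fun _ => (1 : ℝ)) ∧
      Tendsto (fun a => u a - (A ⊓ Bᗮ).starProjection (y a)) l (𝓝 0) := by
  set W := A ⊓ Bᗮ with hW
  have htpos : ∀ᶠ a in l, 0 < t a := ht.eventually self_mem_nhdsWithin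
  obtain ⟨C, hC⟩ := h.exists_bound_of_localDiv_le hs ht hy
  have huO : u =O[l] fun _ => (1 : ℝ) := by
    refine IsBigO.of_bound C ?_
    filter_upwards [hC, hu, hmin] with a hC hu hmin
    simpa using hC _ (localModel_pos hu) (hmin (zero_mem_localModel _))
  refine ⟨huO, ?_⟩
  have hproj : ∀ {z : α → EuclideanSpace ℝ ι}, (z =O[l] fun _ => (1 : ℝ)) →
      (fun a => W.starProjection (z a)) =O[l] fun _ => (1 : ℝ) := fun {z} hz =>
    (W.starProjection.isBigO_comp z l).trans hz
  have hPy := hproj hy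
  have hPu := hproj huO
  -- The competitor v lies in the model and approximates the projection of y; comparing the
  -- minimizer u with it pins u down.
  obtain ⟨v, hv, hvw⟩ := exists_localModel_approx hs hreg ht hPy
    fun a => W.starProjection_apply_mem _
  have hvO : v =O[l] fun _ => (1 : ℝ) := by
    simpa using ((isLittleO_one_iff ℝ).2 hvw).isBigO.add hPy
  have htan := tendsto_sub_starProjection_of_localModel hs ht huO hu
  have hDu := h.tendsto_localDiv hs ht hy huO
  have hDv := h.tendsto_localDiv hs ht hy hvO
  have hNu : Tendsto (fun a => ‖y a - u a‖ ^ 2 - ‖y a - W.starProjection (u a)‖ ^ 2) l (𝓝 0) := by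
    refine tendsto_normSq_sub_normSq (hy.sub huO) ?_
    simpa using htan.neg
  have hNv : Tendsto (fun a => ‖y a - v a‖ ^ 2 - ‖y a - W.starProjection (y a)‖ ^ 2) l (𝓝 0) := by
    refine tendsto_normSq_sub_normSq (hy.sub hvO) ?_
    simpa using hvw.neg
  have hpyth : ∀ a, ‖y a - W.starProjection (u a)‖ ^ 2 = ‖y a - W.starProjection (y a)‖ ^ 2 +
      ‖W.starProjection (u a) - W.starProjection (y a)‖ ^ 2 := by
    intro a
    have h1 : inner ℝ (y a - W.starProjection (y a))
        (W.starProjection (y a) - W.starProjection (u a)) = 0 :=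
      W.starProjection_inner_eq_zero _ _
        (W.sub_mem (W.starProjection_apply_mem _) (W.starProjection_apply_mem _))
    have h2 := norm_add_sq_eq_norm_sq_add_norm_sq_of_inner_eq_zero _ _ h1
    rw [sub_add_sub_cancel] at h2
    rw [norm_sub_rev (W.starProjection (u a))]
    simpa [sq] using h2
  -- After cancellation this is σ/2 (‖y - P u‖² - ‖y - P y‖²) plus the rescaled divergence gap
  -- between v and u. The gap is nonnegative and the rest is σ/2 ‖P u - P y‖² by Pythagoras, so that
  -- square is squeezed to 0.
  have hup : Tendsto (fun a => σ / 2 * (‖y a - v a‖ ^ 2 - ‖y a - W.starProjection (y a)‖ ^ 2)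
      - σ / 2 * (‖y a - u a‖ ^ 2 - ‖y a - W.starProjection (u a)‖ ^ 2)
      + (((t a ^ 2)⁻¹ * localDiv ψ s (t a) (y a) (v a) - σ / 2 * ‖y a - v a‖ ^ 2)
      - ((t a ^ 2)⁻¹ * localDiv ψ s (t a) (y a) (u a) - σ / 2 * ‖y a - u a‖ ^ 2))) l (𝓝 0) := by
    simpa using ((hNv.const_mul (σ / 2)).sub (hNu.const_mul (σ / 2))).add (hDv.sub hDu)
  have hsq : Tendsto (fun a => σ / 2 * ‖W.starProjection (u a) - W.starProjection (y a)‖ ^ 2) l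
      (𝓝 0) := by
    refine squeeze_zero' (Eventually.of_forall fun a => by have := h.pos; positivity) ?_ hup
    filter_upwards [htpos, hv, hmin] with a hta hva hmina
    have h1 : localDiv ψ s (t a) (y a) (u a) ≤ localDiv ψ s (t a) (y a) (v a) := hmina hva
    have h2 : (t a ^ 2)⁻¹ * localDiv ψ s (t a) (y a) (u a) ≤
        (t a ^ 2)⁻¹ * localDiv ψ s (t a) (y a) (v a) := by gcongr
    rw [hpyth a]
    linarith
  have hsq' : Tendsto (fun a => ‖W.starProjection (u a) - W.starProjection (y a)‖) l (𝓝 0) := by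
    have h1 := (hsq.const_mul (2 / σ)).sqrt
    rw [mul_zero, Real.sqrt_zero] at h1
    refine h1.congr fun a => ?_
    have := h.pos.ne'
    rw [← mul_assoc, show 2 / σ * (σ / 2) = 1 by field_simp, one_mul,
      Real.sqrt_sq (norm_nonneg _)]
  have := htan.add (tendsto_zero_iff_norm_tendsto_zero.2 hsq')
  simpa only [← hW, sub_add_sub_cancel, add_zero] using this

end MinimumDivergence

/-! ### Local coordinates around `N p` -/

section LocalCoordinates

variable {k : ℕ} {p : Fin k → ℝ}

/-- The linear map `x ↦ √p x`. -/
noncomputable def rootScale (p : Fin k → ℝ) : (Fin k → ℝ) →ₗ[ℝ] EuclideanSpace ℝ (Fin k) where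
  toFun x := WithLp.toLp 2 fun i => √(p i) * x i
  map_add' x y := by ext i; simp [mul_add]
  map_smul' a x := by ext i; simp; ring

@[simp]
theorem rootScale_apply (p x : Fin k → ℝ) (i : Fin k) : rootScale p x i = √(p i) * x i := rfl

theorem rootScale_injective (hp : ∀ i, 0 < p i) : Function.Injective (rootScale p) := by
  intro x y h
  ext i
  have h1 : √(p i) * x i = √(p i) * y i := congrArg (fun v : EuclideanSpace ℝ (Fin k) => v i) h
  exact mul_left_cancel₀ (Real.sqrt_pos.2 (hp i)).ne' h1

/-- Local coordinates of the vector `m` around `N p`. -/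
noncomputable def localCoord (p : Fin k → ℝ) (N : ℝ) (m : Fin k → ℝ) :
    EuclideanSpace ℝ (Fin k) :=
  WithLp.toLp 2 fun i => (m i - N * p i) / (√(p i) * √N)

@[simp]
theorem localCoord_apply (p : Fin k → ℝ) (N : ℝ) (m : Fin k → ℝ) (i : Fin k) :
    localCoord p N m i = (m i - N * p i) / (√(p i) * √N) := rfl

theorem one_add_localCoord (hp : ∀ i, 0 < p i) {N : ℝ} (hN : 0 < N) (m : Fin k → ℝ) (i : Fin k) :
    1 + (√N)⁻¹ * (localCoord p N m i / √(p i)) = m i / (N * p i) := by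
  have h1 := (Real.sqrt_pos.2 (hp i)).ne'
  have h2 := (Real.sqrt_pos.2 hN).ne'
  have h3 := (hp i).ne'
  have h4 : (√N)⁻¹ * (localCoord p N m i / √(p i)) = (m i - N * p i) / ((√(p i)) ^ 2 * √N ^ 2) := by
    simp only [localCoord_apply]
    field_simp
  rw [h4, Real.sq_sqrt (hp i).le, Real.sq_sqrt hN.le]
  field_simp
  ring

theorem inner_rootScale_localCoord (hp : ∀ i, 0 < p i) (N : ℝ) (x m : Fin k → ℝ) :
    inner ℝ (rootScale p x) (localCoord p N m) = (√N)⁻¹ * (x ⬝ᵥ (m - N • p)) := by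
  rw [PiLp.inner_apply, dotProduct, Finset.mul_sum]
  refine Finset.sum_congr rfl fun i _ => ?_
  have h1 := (Real.sqrt_pos.2 (hp i)).ne'
  simp only [rootScale_apply, localCoord_apply, RCLike.inner_apply, conj_trivial, Pi.sub_apply,
    Pi.smul_apply, smul_eq_mul]
  field_simp

theorem localCoord_mem_orthogonal_iff (hp : ∀ i, 0 < p i) {ι : Type*} [Fintype ι]
    (L : Matrix (Fin k) ι ℝ) {N : ℝ} (hN : 0 < N)
    (m : Fin k → ℝ) :
    localCoord p N m ∈ ((LinearMap.range L.mulVecLin).map (rootScale p))ᗮ ↔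
      Lᵀ *ᵥ (m - N • p) = 0 := by
  have h0 : (√N)⁻¹ ≠ 0 := (inv_pos.2 (Real.sqrt_pos.2 hN)).ne'
  rw [Submodule.mem_orthogonal]
  constructor
  · intro h
    refine dotProduct_eq_zero _ fun x => ?_
    have h1 := h (rootScale p (L *ᵥ x)) ⟨_, ⟨x, rfl⟩, rfl⟩
    rw [inner_rootScale_localCoord hp, mul_eq_zero, or_iff_right h0] at h1
    rw [← h1, Matrix.mulVec_transpose, ← Matrix.dotProduct_mulVec, dotProduct_comm]
  · rintro h _ ⟨_, ⟨x, rfl⟩, rfl⟩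
    rw [inner_rootScale_localCoord hp, Matrix.mulVecLin_apply, dotProduct_comm,
      Matrix.dotProduct_mulVec, ← Matrix.mulVec_transpose, h, zero_dotProduct, mul_zero]

theorem EReal.sum_coe {ι : Type*} (s : Finset ι) (f : ι → ℝ) :
    ∑ i ∈ s, (f i : EReal) = ((∑ i ∈ s, f i : ℝ) : EReal) := by
  classical
  induction s using Finset.induction_on with
  | empty => simp
  | insert i s hi ih => rw [Finset.sum_insert hi, Finset.sum_insert hi, ih, EReal.coe_add]

/-- Strict positivity of both vectors avoids the extended values of φ and the conventions for zero
cells. -/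
theorem phiDiv_eq_localDiv (hp : ∀ i, 0 < p i) {φ : ℝ → EReal} (hφ : IsPhi φ) {N : ℝ} (hN : 0 < N)
    {a b : Fin k → ℝ} (ha : ∀ i, 0 < a i) (hb : ∀ i, 0 < b i) :
    phiDiv φ a b = ((N * localDiv (fun x => (φ x).toReal) (fun i => √(p i)) (√N)⁻¹
      (localCoord p N a) (localCoord p N b) : ℝ) : EReal) := by
  have h1 : ∀ i, (if b i = 0 then (a i : EReal) * limsup (fun u : ℝ => φ u / (u : EReal)) atTop
      else (b i : EReal) * φ (a i / b i)) = ((b i * (φ (a i / b i)).toReal : ℝ) : EReal) := by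
    intro i
    rw [if_neg (hb i).ne', EReal.coe_mul, hφ.coe_toReal (div_pos (ha i) (hb i))]
  rw [phiDiv, Finset.sum_congr rfl fun i _ => h1 i, EReal.sum_coe]
  congr 1
  rw [localDiv, Finset.mul_sum]
  refine Finset.sum_congr rfl fun i _ => ?_
  rw [one_add_localCoord hp hN, one_add_localCoord hp hN, Real.sq_sqrt (hp i).le]
  have h2 := (hp i).ne'
  have h3 := (hb i).ne'
  have h4 : a i / (N * p i) / (b i / (N * p i)) = a i / b i := by field_simp
  rw [h4]
  field_simp

end LocalCoordinates

/-! ### Loglinear models in local coordinates: tangent spaces and dimensions -/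

namespace LMLC

variable {k : ℕ} {S : SamplingPlan k} {p : Fin k → ℝ}

/-- The column space of `X` in local coordinates. -/
noncomputable def logSpace (M : LMLC S) (p : Fin k → ℝ) : Submodule ℝ (EuclideanSpace ℝ (Fin k)) :=
  (LinearMap.range M.X.mulVecLin).map (rootScale p)

/-- The column space of `L` in local coordinates. -/
noncomputable def constraintSpace (M : LMLC S) (p : Fin k → ℝ) :
    Submodule ℝ (EuclideanSpace ℝ (Fin k)) :=
  (LinearMap.range M.L.mulVecLin).map (rootScale p)

/-- The tangent space of the model in local coordinates. -/
noncomputable def tangentSpace (M : LMLC S) (p : Fin k → ℝ) :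
    Submodule ℝ (EuclideanSpace ℝ (Fin k)) :=
  M.logSpace p ⊓ (M.constraintSpace p)ᗮ

theorem mean_pos (M : LMLC S) (θ : Fin M.t → ℝ) (i : Fin k) : 0 < M.mean θ i := Real.exp_pos _

theorem Holds.pos {M : LMLC S} {N : ℝ} (hN : 0 < N) (h : M.Holds N (N • p)) (i : Fin k) :
    0 < p i := by
  obtain ⟨θ, -, hθ⟩ := h
  have h1 := M.mean_pos θ i
  rw [hθ] at h1
  exact (mul_pos_iff_of_pos_left hN).1 h1

theorem Holds.mulVec_eq {M : LMLC S} {N : ℝ} (h : M.Holds N (N • p)) :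
    M.Lᵀ *ᵥ (N • p) = Sum.elim (S.X0ᵀ *ᵥ (N • p)) (N • M.dstar) := by
  obtain ⟨θ, hΘ, hθ⟩ := h
  have h1 : M.Lᵀ *ᵥ M.mean θ = _ := hΘ
  rwa [hθ] at h1

theorem mem_paramSpace_iff {M : LMLC S} {N : ℝ} (h : M.Holds N (N • p)) {n : Fin k → ℝ}
    (hn : S.X0ᵀ *ᵥ n = S.X0ᵀ *ᵥ (N • p)) (θ : Fin M.t → ℝ) :
    θ ∈ M.paramSpace N n ↔ M.Lᵀ *ᵥ (M.mean θ - N • p) = 0 := by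
  rw [Matrix.mulVec_sub, sub_eq_zero, h.mulVec_eq, ← hn]
  rfl

/-- If θ₀ is a true parameter, log(m(θ) / (N p)) = X (θ - θ₀), which supplies ζ. The constraints
become homogeneous because the table has the same subtable totals as the true mean. -/
theorem localCoord_mean_mem (hp : ∀ i, 0 < p i) {M : LMLC S} {N : ℝ} (hN : 0 < N)
    (h : M.Holds N (N • p)) {n : Fin k → ℝ} (hn : S.X0ᵀ *ᵥ n = S.X0ᵀ *ᵥ (N • p))
    {θ : Fin M.t → ℝ} (hθ : θ ∈ M.paramSpace N n) :
    localCoord p N (M.mean θ) ∈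
      localModel (fun i => √(p i)) (M.logSpace p) (M.constraintSpace p) (√N)⁻¹ := by
  refine ⟨(localCoord_mem_orthogonal_iff hp M.L hN _).2 ((mem_paramSpace_iff h hn θ).1 hθ), ?_⟩
  obtain ⟨θ₀, -, hθ₀⟩ := h
  refine ⟨rootScale p (M.X *ᵥ (θ - θ₀)), ⟨_, ⟨_, rfl⟩, rfl⟩, fun i => ?_⟩
  have h1 := (Real.sqrt_pos.2 (hp i)).ne'
  have h2 : M.mean θ₀ i = N * p i := congrFun hθ₀ i
  rw [one_add_localCoord hp hN, ← h2, rootScale_apply, mul_div_cancel_left₀ _ h1,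
    Matrix.mulVec_sub, Pi.sub_apply, Real.exp_sub]
  rfl

theorem exists_mem_paramSpace (hp : ∀ i, 0 < p i) {M : LMLC S} {N : ℝ} (hN : 0 < N)
    (h : M.Holds N (N • p)) {n : Fin k → ℝ} (hn : S.X0ᵀ *ᵥ n = S.X0ᵀ *ᵥ (N • p))
    {u : EuclideanSpace ℝ (Fin k)} (hu : u ∈
      localModel (fun i => √(p i)) (M.logSpace p) (M.constraintSpace p) (√N)⁻¹) :
    ∃ θ ∈ M.paramSpace N n, localCoord p N (M.mean θ) = u := by
  obtain ⟨hB, _, ⟨_, ⟨β, rfl⟩, rfl⟩, hζ⟩ := hu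
  have h' := h
  obtain ⟨θ₀, -, hθ₀⟩ := h'
  have hloc : localCoord p N (M.mean (θ₀ + β)) = u := by
    ext i
    have h1 := (Real.sqrt_pos.2 (hp i)).ne'
    have h2 : M.mean θ₀ i = N * p i := congrFun hθ₀ i
    have h3 : M.mean (θ₀ + β) i = N * p i * Real.exp ((M.X *ᵥ β) i) := by
      rw [← h2, mean, mean, Matrix.mulVec_add, Pi.add_apply, Real.exp_add]
    have h4 := hζ i
    rw [rootScale_apply, mul_div_cancel_left₀ _ h1, Matrix.mulVecLin_apply] at h4
    have h5 := one_add_localCoord hp hN (M.mean (θ₀ + β)) i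
    have h6 : M.mean (θ₀ + β) i / (N * p i) = Real.exp ((M.X *ᵥ β) i) := by
      rw [h3, mul_div_cancel_left₀ _ (mul_pos hN (hp i)).ne']
    rw [h6, ← h4, add_right_inj] at h5
    have h7 := mul_left_cancel₀ (inv_pos.2 (Real.sqrt_pos.2 hN)).ne' h5
    exact (div_left_inj' h1).1 h7
  refine ⟨θ₀ + β, (mem_paramSpace_iff h hn _).2 ?_, hloc⟩
  rw [← localCoord_mem_orthogonal_iff hp M.L hN, hloc]
  exact hB

/-- The inner product of √p X β with √p L x is β · (Xᵀ D_p L x), so orthogonality to the log space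
puts x in the kernel of a matrix of full column rank. -/
theorem RegularAt.inf_eq_bot (hp : ∀ i, 0 < p i) {M : LMLC S} (h : M.RegularAt p) :
    M.constraintSpace p ⊓ (M.logSpace p)ᗮ = ⊥ := by
  rw [Submodule.eq_bot_iff]
  rintro _ ⟨⟨_, ⟨x, rfl⟩, rfl⟩, hx⟩
  have hinj : Function.Injective (M.Xᵀ * Matrix.diagonal p * M.L).mulVec := by
    have h1 := LinearMap.finrank_range_add_finrank_ker
      (M.Xᵀ * Matrix.diagonal p * M.L).mulVecLin
    have h2 : Module.finrank ℝ (LinearMap.range (M.Xᵀ * Matrix.diagonal p * M.L).mulVecLin) =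
      S.c + M.r := h
    rw [h2, Module.finrank_fintype_fun_eq_card, Fintype.card_sum, Fintype.card_fin,
      Fintype.card_fin, Nat.add_eq_left, Submodule.finrank_eq_zero] at h1
    exact LinearMap.ker_eq_bot.1 h1
  have hzero : (M.Xᵀ * Matrix.diagonal p * M.L) *ᵥ x = 0 := by
    refine dotProduct_eq_zero _ fun β => ?_
    have h1 := (Submodule.mem_orthogonal _ _).1 hx (rootScale p (M.X *ᵥ β)) ⟨_, ⟨β, rfl⟩, rfl⟩
    rw [← h1, ← Matrix.mulVec_mulVec, ← Matrix.mulVec_mulVec, Matrix.mulVec_transpose,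
      ← Matrix.dotProduct_mulVec, PiLp.inner_apply, dotProduct]
    refine Finset.sum_congr rfl fun i _ => ?_
    rw [Matrix.mulVec_diagonal]
    simp only [Matrix.mulVecLin_apply, rootScale_apply, RCLike.inner_apply, conj_trivial]
    have := Real.mul_self_sqrt (hp i).le
    linear_combination ((M.L *ᵥ x) i * (M.X *ᵥ β) i) * (-this)
  have hx0 : x = 0 := hinj (by rw [hzero, Matrix.mulVec_zero])
  simp [hx0]

theorem finrank_logSpace (hp : ∀ i, 0 < p i) (M : LMLC S) :
    Module.finrank ℝ (M.logSpace p) = M.t := by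
  exact (Submodule.equivMapOfInjective _ (rootScale_injective hp) _).finrank_eq.symm.trans M.rank_X

theorem finrank_constraintSpace (hp : ∀ i, 0 < p i) (M : LMLC S) :
    Module.finrank ℝ (M.constraintSpace p) = S.c + M.r := by
  exact (Submodule.equivMapOfInjective _ (rootScale_injective hp) _).finrank_eq.symm.trans M.rank_L

theorem finrank_tangentSpace_add (hp : ∀ i, 0 < p i) {M : LMLC S}
    (h : M.constraintSpace p ⊓ (M.logSpace p)ᗮ = ⊥) :
    Module.finrank ℝ (M.tangentSpace p) + (S.c + M.r) = M.t := by
  have h1 := Submodule.finrank_add_finrank_orthogonal (M.tangentSpace p)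
  have h2 := Submodule.finrank_add_finrank_orthogonal (M.logSpace p)
  have h3 := Submodule.finrank_sup_add_finrank_inf_eq (M.logSpace p)ᗮ (M.constraintSpace p)
  rw [inf_comm, h, finrank_bot, M.finrank_constraintSpace hp] at h3
  rw [tangentSpace, orthogonal_inf_orthogonal] at h1
  rw [M.finrank_logSpace hp] at h2
  rw [tangentSpace]
  omega

namespace NestedWithin

variable {M' M : LMLC S}

theorem logSpace_le (h : M'.NestedWithin M) : M'.logSpace p ≤ M.logSpace p :=
  Submodule.map_mono h.1

theorem constraintSpace_le (h : M'.NestedWithin M) :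
    M.constraintSpace p ≤ M'.constraintSpace p :=
  Submodule.map_mono h.2.1

theorem tangentSpace_le (h : M'.NestedWithin M) : M'.tangentSpace p ≤ M.tangentSpace p :=
  inf_le_inf h.logSpace_le (Submodule.orthogonal_le h.constraintSpace_le)

/-- Transversality passes from a model to any model containing it, so it need only be assumed for
the smallest model of a chain. -/
theorem inf_eq_bot (h : M'.NestedWithin M)
    (h' : M'.constraintSpace p ⊓ (M'.logSpace p)ᗮ = ⊥) :
    M.constraintSpace p ⊓ (M.logSpace p)ᗮ = ⊥ :=
  eq_bot_iff.2 ((inf_le_inf h.constraintSpace_le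
    (Submodule.orthogonal_le h.logSpace_le)).trans h'.le)

theorem df_pos (h : M'.NestedWithin M) : 0 < df M' M := by
  obtain ⟨-, -, h1, h2, h3⟩ := h
  unfold df
  omega

/-- Each tangent space has dimension t - c - r, and the difference of two of them is the number of
degrees of freedom. -/
theorem finrank_inf_orthogonal (h : M'.NestedWithin M) (hp : ∀ i, 0 < p i)
    (h' : M'.constraintSpace p ⊓ (M'.logSpace p)ᗮ = ⊥) :
    Module.finrank ℝ (M.tangentSpace p ⊓ (M'.tangentSpace p)ᗮ :
      Submodule ℝ (EuclideanSpace ℝ (Fin k))) = df M' M := by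
  have h1 := finrank_tangentSpace_add hp h'
  have h2 := finrank_tangentSpace_add hp (h.inf_eq_bot h')
  have h3 := Submodule.finrank_add_inf_finrank_orthogonal (h.tangentSpace_le (p := p))
  obtain ⟨-, -, h4, h5, -⟩ := h
  rw [inf_comm] at h3
  unfold df
  omega

end NestedWithin

end LMLC

/-! ### Quadratic approximation of the test statistics -/

section Statistics

variable {k : ℕ} {S : SamplingPlan k} {p : Fin k → ℝ} {J : Type*} {l : Filter J} {N : J → ℝ}
  {n : J → Fin k → ℕ}

theorem tendsto_inv_sqrt (hN : Tendsto N l atTop) :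
    Tendsto (fun j => (√(N j))⁻¹) l (𝓝[>] 0) :=
  tendsto_inv_atTop_nhdsGT_zero.comp (Real.tendsto_sqrt_atTop.comp hN)

theorem eventually_tableVec_pos (hp : ∀ i, 0 < p i) (hN : Tendsto N l atTop)
    (hy : (fun j => localCoord p (N j) (tableVec (n j))) =O[l] fun _ => (1 : ℝ)) :
    ∀ᶠ j in l, ∀ i, 0 < tableVec (n j) i := by
  obtain ⟨K, hK⟩ := hy.bound
  have hs : ∀ i, 0 < √(p i) := fun i => Real.sqrt_pos.2 (hp i)
  filter_upwards [hK, hN.eventually (eventually_gt_atTop 0),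
    eventually_one_add_pos hs ((tendsto_inv_sqrt hN).mono_right nhdsWithin_le_nhds) K]
    with j hK hNj h i
  have h1 := h _ (by simpa using hK) i
  rw [one_add_localCoord hp hNj] at h1
  exact (div_pos_iff_of_pos_right (mul_pos hNj (hp i))).1 h1

theorem IsMinPhiEstimator.eventually_isMinPhiDiv {M : LMLC S} {φ : ℝ → EReal} (hφ : IsPhi φ)
    (hp : ∀ i, 0 < p i) (hN : Tendsto N l atTop) (hM : ∀ j, M.Holds (N j) (N j • p))
    (hy : (fun j => localCoord p (N j) (tableVec (n j))) =O[l] fun _ => (1 : ℝ))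
    (htot : ∀ᶠ j in l, S.X0ᵀ *ᵥ tableVec (n j) = S.X0ᵀ *ᵥ (N j • p))
    {est : J → (Fin k → ℕ) → Fin M.t → ℝ} (hest : ∀ j, IsMinPhiEstimator M φ (N j) (est j)) :
    ∀ᶠ j in l, IsMinPhiDiv M φ (N j) (n j) (est j (n j)) := by
  have hs : ∀ i, 0 < √(p i) := fun i => Real.sqrt_pos.2 (hp i)
  have hex := hφ.isRealPhi.eventually_exists_isMinOn (A := M.logSpace p)
    (B := M.constraintSpace p) hs (tendsto_inv_sqrt hN) hy
  filter_upwards [hex, eventually_tableVec_pos hp hN hy, htot,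
    hN.eventually (eventually_gt_atTop 0)] with j ⟨u, hu, hmin⟩ hpos htot hNj
  refine hest j (n j) ?_
  obtain ⟨θ, hθ, hθu⟩ := LMLC.exists_mem_paramSpace hp hNj (hM j) htot hu
  refine ⟨θ, hθ, fun θ' hθ' => ?_⟩
  have h1 := hmin (LMLC.localCoord_mean_mem hp hNj (hM j) htot hθ')
  change phiDiv φ _ _ ≤ phiDiv φ _ _
  rw [phiDiv_eq_localDiv hp hφ hNj hpos (M.mean_pos _),
    phiDiv_eq_localDiv hp hφ hNj hpos (M.mean_pos _), EReal.coe_le_coe_iff, hθu]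
  exact mul_le_mul_of_nonneg_left h1 hNj.le

/-- The estimated mean vector is asymptotically the projection of the table onto the tangent
space. -/
theorem IsMinPhiEstimator.tendsto_sub {M : LMLC S} {φ : ℝ → EReal} (hφ : IsPhi φ)
    (hp : ∀ i, 0 < p i) (hN : Tendsto N l atTop) (hM : ∀ j, M.Holds (N j) (N j • p))
    (hreg : M.constraintSpace p ⊓ (M.logSpace p)ᗮ = ⊥)
    (hy : (fun j => localCoord p (N j) (tableVec (n j))) =O[l] fun _ => (1 : ℝ))
    (htot : ∀ᶠ j in l, S.X0ᵀ *ᵥ tableVec (n j) = S.X0ᵀ *ᵥ (N j • p))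
    {est : J → (Fin k → ℕ) → Fin M.t → ℝ} (hest : ∀ j, IsMinPhiEstimator M φ (N j) (est j)) :
    ((fun j => localCoord p (N j) (M.mean (est j (n j)))) =O[l] fun _ => (1 : ℝ)) ∧
    Tendsto (fun j => localCoord p (N j) (M.mean (est j (n j))) -
      (M.tangentSpace p).starProjection (localCoord p (N j) (tableVec (n j)))) l (𝓝 0) := by
  have hs : ∀ i, 0 < √(p i) := fun i => Real.sqrt_pos.2 (hp i)
  have hmin := IsMinPhiEstimator.eventually_isMinPhiDiv hφ hp hN hM hy htot hest
  refine hφ.isRealPhi.tendsto_sub_of_isMinOn hs hreg (tendsto_inv_sqrt hN) hy ?_ ?_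
  · filter_upwards [hmin, htot, hN.eventually (eventually_gt_atTop 0)] with j hm htot hNj
    exact LMLC.localCoord_mean_mem hp hNj (hM j) htot hm.1
  · filter_upwards [hmin, htot, hN.eventually (eventually_gt_atTop 0),
      eventually_tableVec_pos hp hN hy] with j hm htot hNj hpos u hu
    obtain ⟨θ, hθ, rfl⟩ := LMLC.exists_mem_paramSpace hp hNj (hM j) htot hu
    have h1 : phiDiv φ _ _ ≤ phiDiv φ _ _ := hm.2 hθ
    rw [phiDiv_eq_localDiv hp hφ hNj hpos (M.mean_pos _),
      phiDiv_eq_localDiv hp hφ hNj hpos (M.mean_pos _), EReal.coe_le_coe_iff] at h1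
    exact le_of_mul_le_mul_left h1 hNj

/-- The quadratic form that approximates the test statistics. -/
noncomputable def testForm (M' M : LMLC S) (p : Fin k → ℝ) (y : EuclideanSpace ℝ (Fin k)) : ℝ :=
  ‖(M.tangentSpace p).starProjection y - (M'.tangentSpace p).starProjection y‖ ^ 2

/-- Pythagoras for nested tangent spaces is the reason why `statS`, a difference of squared
distances, has the same limit as `statT`, a squared distance between projections. -/
theorem testForm_eq_sub {M' M : LMLC S} (h : M'.NestedWithin M) (y : EuclideanSpace ℝ (Fin k)) :
    testForm M' M p y = ‖y - (M'.tangentSpace p).starProjection y‖ ^ 2 -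
      ‖y - (M.tangentSpace p).starProjection y‖ ^ 2 := by
  set W := M.tangentSpace p
  set W' := M'.tangentSpace p
  have hle : W' ≤ W := h.tangentSpace_le
  have h1 : inner ℝ (y - W.starProjection y) (W.starProjection y - W'.starProjection y) = 0 :=
    W.starProjection_inner_eq_zero _ _
      (W.sub_mem (W.starProjection_apply_mem _) (hle (W'.starProjection_apply_mem _)))
  have h2 := norm_add_sq_eq_norm_sq_add_norm_sq_of_inner_eq_zero _ _ h1
  rw [sub_add_sub_cancel] at h2
  unfold testForm
  linarith

theorem sqrt_inv_sq_inv {x : ℝ} (hx : 0 < x) : (((√x)⁻¹) ^ 2)⁻¹ = x := by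
  rw [inv_pow, inv_inv, Real.sq_sqrt hx.le]

/-- The test statistic `T` is asymptotically a quadratic form in the table. -/
theorem statT_approx {M' M : LMLC S} {φ φ' : ℝ → EReal} (hφ : IsPhi φ) (hφ' : IsPhi φ')
    (hp : ∀ i, 0 < p i) (hN : Tendsto N l atTop) (hM : ∀ j, M.Holds (N j) (N j • p))
    (hM' : ∀ j, M'.Holds (N j) (N j • p))
    (hreg : M.constraintSpace p ⊓ (M.logSpace p)ᗮ = ⊥)
    (hreg' : M'.constraintSpace p ⊓ (M'.logSpace p)ᗮ = ⊥)
    (hy : (fun j => localCoord p (N j) (tableVec (n j))) =O[l] fun _ => (1 : ℝ))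
    (htot : ∀ᶠ j in l, S.X0ᵀ *ᵥ tableVec (n j) = S.X0ᵀ *ᵥ (N j • p))
    {est : J → (Fin k → ℕ) → Fin M.t → ℝ} (hest : ∀ j, IsMinPhiEstimator M φ (N j) (est j))
    {est' : J → (Fin k → ℕ) → Fin M'.t → ℝ}
    (hest' : ∀ j, IsMinPhiEstimator M' φ (N j) (est' j)) :
    ∃ f : J → ℝ, (∀ᶠ j in l, statT M' M φ' (est' j (n j)) (est j (n j)) = f j) ∧
      Tendsto (fun j => f j - testForm M' M p (localCoord p (N j) (tableVec (n j)))) l (𝓝 0) := by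
  have hs : ∀ i, 0 < √(p i) := fun i => Real.sqrt_pos.2 (hp i)
  obtain ⟨hu, hup⟩ := IsMinPhiEstimator.tendsto_sub hφ hp hN hM hreg hy htot hest
  obtain ⟨hu', hup'⟩ := IsMinPhiEstimator.tendsto_sub hφ hp hN hM' hreg' hy htot hest'
  have hD := hφ'.isRealPhi.tendsto_localDiv hs (tendsto_inv_sqrt hN) hu hu'
  have hQ := tendsto_normSq_sub_normSq (hu.sub hu') (g := fun j =>
    (M.tangentSpace p).starProjection (localCoord p (N j) (tableVec (n j))) -
    (M'.tangentSpace p).starProjection (localCoord p (N j) (tableVec (n j)))) (by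
      have := hup.sub hup'
      rw [sub_zero] at this
      refine this.congr fun j => ?_
      abel)
  refine ⟨fun j => 2 / phiSecond φ' * (N j * localDiv (fun x => (φ' x).toReal) (fun i => √(p i))
    (√(N j))⁻¹ (localCoord p (N j) (M.mean (est j (n j))))
    (localCoord p (N j) (M'.mean (est' j (n j))))), ?_, ?_⟩
  · filter_upwards [hN.eventually (eventually_gt_atTop 0)] with j hNj
    rw [statT, phiDiv_eq_localDiv hp hφ' hNj (M.mean_pos _) (M'.mean_pos _), ← EReal.coe_mul]
  · have h1 := (hD.const_mul (2 / phiSecond φ')).add hQ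
    rw [mul_zero, add_zero] at h1
    refine h1.congr' ?_
    filter_upwards [hN.eventually (eventually_gt_atTop 0)] with j hNj
    have := hφ'.second_pos.ne'
    rw [sqrt_inv_sq_inv hNj, testForm]
    field_simp
    ring

/-- The test statistic `S` is asymptotically a quadratic form in the table. -/
theorem statS_approx {M' M : LMLC S} {φ : ℝ → EReal} (hφ : IsPhi φ)
    (hnest : M'.NestedWithin M)
    (hp : ∀ i, 0 < p i) (hN : Tendsto N l atTop) (hM : ∀ j, M.Holds (N j) (N j • p))
    (hM' : ∀ j, M'.Holds (N j) (N j • p))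
    (hreg : M.constraintSpace p ⊓ (M.logSpace p)ᗮ = ⊥)
    (hreg' : M'.constraintSpace p ⊓ (M'.logSpace p)ᗮ = ⊥)
    (hy : (fun j => localCoord p (N j) (tableVec (n j))) =O[l] fun _ => (1 : ℝ))
    (htot : ∀ᶠ j in l, S.X0ᵀ *ᵥ tableVec (n j) = S.X0ᵀ *ᵥ (N j • p))
    {est : J → (Fin k → ℕ) → Fin M.t → ℝ} (hest : ∀ j, IsMinPhiEstimator M φ (N j) (est j))
    {est' : J → (Fin k → ℕ) → Fin M'.t → ℝ}
    (hest' : ∀ j, IsMinPhiEstimator M' φ (N j) (est' j)) :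
    ∃ f : J → ℝ, (∀ᶠ j in l, statS M' M φ (n j) (est' j (n j)) (est j (n j)) = f j) ∧
      Tendsto (fun j => f j - testForm M' M p (localCoord p (N j) (tableVec (n j)))) l (𝓝 0) := by
  have hs : ∀ i, 0 < √(p i) := fun i => Real.sqrt_pos.2 (hp i)
  obtain ⟨hu, hup⟩ := IsMinPhiEstimator.tendsto_sub hφ hp hN hM hreg hy htot hest
  obtain ⟨hu', hup'⟩ := IsMinPhiEstimator.tendsto_sub hφ hp hN hM' hreg' hy htot hest'
  have hD := hφ.isRealPhi.tendsto_localDiv hs (tendsto_inv_sqrt hN) hy hu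
  have hD' := hφ.isRealPhi.tendsto_localDiv hs (tendsto_inv_sqrt hN) hy hu'
  have hQ := tendsto_normSq_sub_normSq (hy.sub hu) (g := fun j =>
    localCoord p (N j) (tableVec (n j)) -
    (M.tangentSpace p).starProjection (localCoord p (N j) (tableVec (n j)))) (by
      have := hup.neg
      rw [neg_zero] at this
      refine this.congr fun j => ?_
      abel)
  have hQ' := tendsto_normSq_sub_normSq (hy.sub hu') (g := fun j =>
    localCoord p (N j) (tableVec (n j)) -
    (M'.tangentSpace p).starProjection (localCoord p (N j) (tableVec (n j)))) (by
      have := hup'.neg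
      rw [neg_zero] at this
      refine this.congr fun j => ?_
      abel)
  refine ⟨fun j => 2 / phiSecond φ * (N j * localDiv (fun x => (φ x).toReal) (fun i => √(p i))
    (√(N j))⁻¹ (localCoord p (N j) (tableVec (n j)))
    (localCoord p (N j) (M'.mean (est' j (n j)))) -
    N j * localDiv (fun x => (φ x).toReal) (fun i => √(p i))
    (√(N j))⁻¹ (localCoord p (N j) (tableVec (n j)))
    (localCoord p (N j) (M.mean (est j (n j))))), ?_, ?_⟩
  · filter_upwards [hN.eventually (eventually_gt_atTop 0), eventually_tableVec_pos hp hN hy]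
      with j hNj hpos
    rw [statS, phiDiv_eq_localDiv hp hφ hNj hpos (M.mean_pos _),
      phiDiv_eq_localDiv hp hφ hNj hpos (M'.mean_pos _), ← EReal.coe_sub, ← EReal.coe_mul]
  · have h1 := ((hD'.sub hD).const_mul (2 / phiSecond φ)).add (hQ'.sub hQ)
    simp only [sub_zero, mul_zero, add_zero] at h1
    refine h1.congr' ?_
    filter_upwards [hN.eventually (eventually_gt_atTop 0)] with j hNj
    have := hφ.second_pos.ne'
    rw [sqrt_inv_sq_inv hNj, testForm_eq_sub hnest]
    field_simp
    ring

end Statistics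

/-! ### Product-multinomial laws and their generating functions -/

namespace SamplingPlan

variable {k c : ℕ}

/-- The tables whose subtable totals are `a`. -/
def tables (stratum : Fin k → Fin c) (a : Fin c → ℕ) : Finset (Fin k → ℕ) :=
  (Fintype.piFinset fun h => Finset.piAntidiag {i | stratum i = h} (a h)).image
    fun f i => f (stratum i) i

theorem sum_filter_piFinset {stratum : Fin k → Fin c} {a : Fin c → ℕ}
    {f : Fin c → Fin k → ℕ}
    (hf : f ∈ Fintype.piFinset fun h => Finset.piAntidiag {i | stratum i = h} (a h)) (h : Fin c) :
    ∑ i with stratum i = h, f (stratum i) i = a h := by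
  rw [Fintype.mem_piFinset] at hf
  rw [← (Finset.mem_piAntidiag.1 (hf h)).1]
  refine Finset.sum_congr rfl fun i hi => ?_
  rw [(Finset.mem_filter.1 hi).2]

theorem mem_tables {stratum : Fin k → Fin c} {a : Fin c → ℕ} {n : Fin k → ℕ} :
    n ∈ tables stratum a ↔ ∀ h, ∑ i with stratum i = h, n i = a h := by
  constructor
  · intro hn h
    obtain ⟨f, hf, rfl⟩ := Finset.mem_image.1 hn
    exact sum_filter_piFinset hf h
  · intro hn
    refine Finset.mem_image.2 ⟨fun h i => if stratum i = h then n i else 0, ?_, ?_⟩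
    · rw [Fintype.mem_piFinset]
      intro h
      rw [Finset.mem_piAntidiag]
      refine ⟨?_, fun i hi => ?_⟩
      · rw [← hn h]
        refine Finset.sum_congr rfl fun i hi => ?_
        rw [if_pos (Finset.mem_filter.1 hi).2]
      · simp only [Finset.mem_filter, Finset.mem_univ, true_and]
        by_contra hne
        exact hi (if_neg hne)
    · ext i
      simp

/-- The multinomial theorem for several subtables. -/
theorem sum_tables_eq_prod {R : Type*} [CommSemiring R] (stratum : Fin k → Fin c) (a : Fin c → ℕ)
    (z : Fin k → R) :
    ∑ n ∈ tables stratum a, ∏ h, ((Nat.multinomial {i | stratum i = h} n : R) *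
      ∏ i with stratum i = h, z i ^ n i) = ∏ h, (∑ i with stratum i = h, z i) ^ a h := by
  have h1 : ∀ h, (∑ i with stratum i = h, z i) ^ a h =
      ∑ f ∈ Finset.piAntidiag {i | stratum i = h} (a h),
        ((Nat.multinomial {i | stratum i = h} f : R) * ∏ i with stratum i = h, z i ^ f i) :=
    fun h => Finset.sum_pow_eq_sum_piAntidiag _ _ _
  rw [Finset.prod_congr rfl fun h _ => h1 h, Finset.prod_univ_sum, tables, Finset.sum_image]
  · refine Finset.sum_congr rfl fun f _ => Finset.prod_congr rfl fun h _ => ?_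
    congr 1
    · rw [Nat.multinomial_congr]
      intro i hi
      rw [(Finset.mem_filter.1 hi).2]
    · refine Finset.prod_congr rfl fun i hi => ?_
      rw [← (Finset.mem_filter.1 hi).2]
  -- Gluing the subtables loses nothing: members of `piAntidiag` vanish outside their own subtable.
  · intro f hf g hg hfg
    ext h i
    by_cases hi : stratum i = h
    · subst hi
      exact congrFun hfg i
    · rw [Finset.mem_coe, Fintype.mem_piFinset] at hf hg
      have hf' := (Finset.mem_piAntidiag.1 (hf h)).2 i
      have hg' := (Finset.mem_piAntidiag.1 (hg h)).2 i
      simp only [Finset.mem_filter, Finset.mem_univ, true_and] at hf' hg'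
      rw [not_imp_comm.1 hf' hi, not_imp_comm.1 hg' hi]

theorem law_productMultinomial (stratum : Fin k → Fin c) {m : Fin k → ℝ} {a : Fin c → ℕ}
    (ha : ∀ h, ∑ i with stratum i = h, m i = a h) :
    (productMultinomial c stratum).law m = ∑ n ∈ tables stratum a, ENNReal.ofReal
      (∏ h, ((Nat.multinomial {i | stratum i = h} n : ℝ) *
        ∏ i with stratum i = h, (m i / a h) ^ n i)) • Measure.dirac n := by
  have hw : ∀ n, productMultinomialWeight stratum m n = if n ∈ tables stratum a then
      (∏ h, ((Nat.multinomial {i | stratum i = h} n : ℝ) *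
        ∏ i with stratum i = h, (m i / a h) ^ n i)) else 0 := by
    intro n
    rw [productMultinomialWeight]
    have hiff : (∀ h, (∑ i with stratum i = h, (n i : ℝ)) = ∑ i with stratum i = h, m i) ↔
        n ∈ tables stratum a := by
      rw [mem_tables]
      refine forall_congr' fun h => ?_
      rw [ha h]
      exact_mod_cast Iff.rfl
    rw [if_congr hiff rfl rfl]
    simp only [ha]
  ext s hs
  simp only [law, Measure.sum_apply _ hs, Measure.finsetSum_apply]
  rw [tsum_eq_sum (s := tables stratum a)]
  · refine Finset.sum_congr rfl fun n hn => ?_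
    rw [hw, if_pos hn]
  · intro n hn
    rw [hw, if_neg hn]
    simp

theorem multinomialTerm_nonneg (stratum : Fin k → Fin c) {m : Fin k → ℝ} (hm : ∀ i, 0 ≤ m i)
    (a : Fin c → ℕ) (n : Fin k → ℕ) :
    0 ≤ ∏ h, ((Nat.multinomial {i | stratum i = h} n : ℝ) *
        ∏ i with stratum i = h, (m i / a h) ^ n i) :=
  Finset.prod_nonneg fun _ _ => mul_nonneg (Nat.cast_nonneg _) <|
    Finset.prod_nonneg fun i _ => pow_nonneg (div_nonneg (hm i) (Nat.cast_nonneg _)) _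

theorem integral_law_productMultinomial (stratum : Fin k → Fin c) {m : Fin k → ℝ}
    (hm : ∀ i, 0 ≤ m i) {a : Fin c → ℕ} (ha : ∀ h, ∑ i with stratum i = h, m i = a h)
    (x : Fin k → ℂ) :
    ∫ n, ∏ i, x i ^ n i ∂(productMultinomial c stratum).law m =
      ∏ h, (∑ i with stratum i = h, (m i / a h : ℝ) * x i) ^ a h := by
  have h0 : ∀ h, ∑ i with stratum i = h, (m i / a h : ℝ) * x i =
      ∑ i with stratum i = h, (m i / a (stratum i) : ℝ) * x i := fun h =>
    Finset.sum_congr rfl fun i hi => by rw [(Finset.mem_filter.1 hi).2]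
  simp only [h0]
  rw [law_productMultinomial stratum ha, integral_finsetSum_measure, ← sum_tables_eq_prod]
  · refine Finset.sum_congr rfl fun n _ => ?_
    rw [integral_smul_measure, integral_dirac,
      ENNReal.toReal_ofReal (multinomialTerm_nonneg stratum hm a n), Complex.real_smul]
    have h1 : ∏ i, x i ^ n i = ∏ h, ∏ i with stratum i = h, x i ^ n i :=
      (Finset.prod_fiberwise _ _ _).symm
    rw [h1, Complex.ofReal_prod, ← Finset.prod_mul_distrib]
    refine Finset.prod_congr rfl fun h _ => ?_
    rw [Complex.ofReal_mul, Complex.ofReal_prod, mul_assoc, ← Finset.prod_mul_distrib]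
    congr 1
    refine Finset.prod_congr rfl fun i hi => ?_
    rw [(Finset.mem_filter.1 hi).2, mul_pow, Complex.ofReal_pow]
  · intro n _
    exact (integrable_dirac (by simp)).smul_measure ENNReal.ofReal_ne_top

theorem isProbabilityMeasure_law_productMultinomial (stratum : Fin k → Fin c) {m : Fin k → ℝ}
    (hm : ∀ i, 0 ≤ m i) {a : Fin c → ℕ} (ha : ∀ h, ∑ i with stratum i = h, m i = a h) :
    IsProbabilityMeasure ((productMultinomial c stratum).law m) := by
  refine ⟨?_⟩
  rw [law_productMultinomial stratum ha, Measure.finsetSum_apply]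
  simp only [Measure.smul_apply, measure_univ, smul_eq_mul, mul_one]
  rw [← ENNReal.ofReal_sum_of_nonneg fun n _ => multinomialTerm_nonneg stratum hm a n]
  have h1 : ∀ n : Fin k → ℕ, ∏ h, ((Nat.multinomial {i | stratum i = h} n : ℝ) *
      ∏ i with stratum i = h, (m i / a h) ^ n i) =
      ∏ h, ((Nat.multinomial {i | stratum i = h} n : ℝ) *
      ∏ i with stratum i = h, (m i / a (stratum i)) ^ n i) := by
    intro n
    refine Finset.prod_congr rfl fun h _ => ?_
    congr 1
    refine Finset.prod_congr rfl fun i hi => ?_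
    rw [(Finset.mem_filter.1 hi).2]
  rw [Finset.sum_congr rfl fun n _ => h1 n, sum_tables_eq_prod]
  have h2 : ∀ h, (∑ i with stratum i = h, m i / a (stratum i)) ^ a h = 1 := by
    intro h
    -- For a total of 0 the ratios take the default value 0, but they are raised to the power 0.
    by_cases h0 : a h = 0
    · rw [h0, pow_zero]
    convert one_pow (a h)
    have : (a h : ℝ) ≠ 0 := Nat.cast_ne_zero.2 h0
    rw [← div_self this, ← ha h, Finset.sum_div]
    refine Finset.sum_congr rfl fun i hi => ?_
    rw [(Finset.mem_filter.1 hi).2, ha h]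
  simp [h2]

end SamplingPlan

/-! ### The central limit theorem for tables, by characteristic functions -/

theorem tendsto_cexp_second_order (b : ℝ) :
    Tendsto (fun τ : ℝ => (Complex.exp ((b * τ : ℝ) * Complex.I) - 1 - (b * τ : ℝ) * Complex.I) /
      (τ : ℂ) ^ 2) (𝓝[>] 0) (𝓝 (-(b : ℂ) ^ 2 / 2)) := by
  have h0 : Tendsto (fun τ : ℝ => |b| ^ 3 * τ * Real.exp (|b| * τ)) (𝓝[>] 0) (𝓝 0) := by
    have : Continuous fun τ : ℝ => |b| ^ 3 * τ * Real.exp (|b| * τ) := by fun_prop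
    simpa using (this.tendsto 0).mono_left nhdsWithin_le_nhds
  rw [tendsto_iff_norm_sub_tendsto_zero]
  refine squeeze_zero' (Eventually.of_forall fun _ => norm_nonneg _) ?_ h0
  filter_upwards [self_mem_nhdsWithin] with τ hτ
  have hτ0 : 0 < τ := hτ
  have hτc : (τ : ℂ) ≠ 0 := by exact_mod_cast hτ0.ne'
  set z : ℂ := (b * τ : ℝ) * Complex.I with hz
  have hzn : ‖z‖ = |b| * τ := by
    rw [hz, norm_mul, Complex.norm_I, mul_one, Complex.norm_real, Real.norm_eq_abs, abs_mul,
      abs_of_pos hτ0]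
  have h1 := Complex.norm_exp_sub_sum_le_norm_mul_exp z 3
  simp only [Finset.sum_range_succ, Finset.sum_range_zero] at h1
  have h2 : (Complex.exp z - 1 - z) / (τ : ℂ) ^ 2 - -(b : ℂ) ^ 2 / 2 =
      (Complex.exp z - (0 + z ^ 0 / (Nat.factorial 0 : ℂ) + z ^ 1 / (Nat.factorial 1 : ℂ) +
        z ^ 2 / (Nat.factorial 2 : ℂ))) / (τ : ℂ) ^ 2 := by
    have : z ^ 2 = -(b : ℂ) ^ 2 * τ ^ 2 := by
      rw [hz, mul_pow, Complex.I_sq]; push_cast; ring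
    rw [this]
    simp only [Nat.factorial]
    field_simp
    push_cast
    ring
  rw [h2, norm_div, norm_pow, Complex.norm_real, Real.norm_eq_abs, abs_of_pos hτ0,
    div_le_iff₀ (by positivity)]
  refine h1.trans (le_of_eq ?_)
  rw [hzn]
  ring

namespace SamplingPlan

variable {k : ℕ} {p : Fin k → ℝ}

/-- The vectors compatible with the prefixed totals, in local coordinates. -/
noncomputable def fluctuationSpace (S : SamplingPlan k) (p : Fin k → ℝ) :
    Submodule ℝ (EuclideanSpace ℝ (Fin k)) :=
  ((LinearMap.range S.X0.mulVecLin).map (rootScale p))ᗮ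

theorem X0_transpose_mulVec {c : ℕ} (stratum : Fin k → Fin c) (v : Fin k → ℝ) (h : Fin c) :
    ((productMultinomial c stratum).X0ᵀ *ᵥ v) h = ∑ i with stratum i = h, v i := by
  change ∑ i, (if stratum i = h then (1 : ℝ) else 0) * v i = _
  simp only [Finset.sum_filter, ite_mul, one_mul, zero_mul]

theorem Admissible.exists_totals {c : ℕ} {stratum : Fin k → Fin c} {m : Fin k → ℝ}
    (h : (productMultinomial c stratum).Admissible m) :
    ∃ a : Fin c → ℕ, ∀ h, ∑ i with stratum i = h, m i = a h := by
  choose a ha using h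
  exact ⟨a, fun h => by rw [← X0_transpose_mulVec]; exact ha h⟩

theorem isProbabilityMeasure_law (S : SamplingPlan k) {m : Fin k → ℝ} (hm : ∀ i, 0 ≤ m i)
    (hadm : S.Admissible m) : IsProbabilityMeasure (S.law m) := by
  cases S with
  | poisson =>
    unfold law
    infer_instance
  | productMultinomial c stratum =>
    obtain ⟨a, ha⟩ := hadm.exists_totals
    exact isProbabilityMeasure_law_productMultinomial stratum hm ha

theorem ae_totals (S : SamplingPlan k) {m : Fin k → ℝ} (hadm : S.Admissible m) :
    ∀ᵐ n ∂S.law m, S.X0ᵀ *ᵥ tableVec n = S.X0ᵀ *ᵥ m := by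
  cases S with
  | poisson => exact Eventually.of_forall fun n => funext fun h => h.elim0
  | productMultinomial c stratum =>
    obtain ⟨a, ha⟩ := hadm.exists_totals
    rw [law_productMultinomial stratum ha, ae_iff, Measure.finsetSum_apply]
    refine Finset.sum_eq_zero fun n hn => ?_
    have h1 : (productMultinomial c stratum).X0ᵀ *ᵥ tableVec n =
        (productMultinomial c stratum).X0ᵀ *ᵥ m := by
      funext h
      refine (X0_transpose_mulVec stratum _ h).trans
        (Eq.trans ?_ (X0_transpose_mulVec stratum _ h).symm)
      rw [ha h]
      simp only [tableVec]
      exact_mod_cast mem_tables.1 hn h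
    rw [Measure.smul_apply, Measure.dirac_apply' _ .of_discrete]
    simp [h1]

theorem ae_localCoord_mem (S : SamplingPlan k) (hp : ∀ i, 0 < p i) {N : ℝ} (hN : 0 < N)
    (hadm : S.Admissible (N • p)) :
    ∀ᵐ n ∂S.law (N • p), localCoord p N (tableVec n) ∈ S.fluctuationSpace p := by
  filter_upwards [S.ae_totals hadm] with n hn
  rw [fluctuationSpace, localCoord_mem_orthogonal_iff hp S.X0 hN, Matrix.mulVec_sub, hn, sub_self]

theorem integral_pow_poissonMeasure (r : ℝ≥0) (t : ℝ) :
    ∫ n, Complex.exp (t * Complex.I) ^ n ∂poissonMeasure r =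
      Complex.exp (r * (Complex.exp (t * Complex.I) - 1)) := by
  rw [← charFun_map_cast_poissonMeasure, charFun_apply, integral_map .of_discrete (by fun_prop)]
  refine integral_congr_ae (Eventually.of_forall fun n => ?_)
  simp only [← Complex.exp_nat_mul, RCLike.inner_apply, conj_trivial]
  congr 1
  push_cast
  ring

/-- Splitting off the deterministic centring leaves the generating function of the table at points
of the unit circle, which is explicit for both sampling plans. -/
theorem charFun_map_localCoord (S : SamplingPlan k) (N : ℝ) (t : EuclideanSpace ℝ (Fin k)) :
    charFun ((S.law (N • p)).map fun n => localCoord p N (tableVec n)) t =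
      Complex.exp (-(∑ i, N * p i * (t i / √(p i) * (√N)⁻¹) : ℝ) * Complex.I) *
      ∫ n, ∏ i, Complex.exp ((t i / √(p i) * (√N)⁻¹ : ℝ) * Complex.I) ^ n i ∂S.law (N • p) := by
  rw [charFun_apply, integral_map .of_discrete (by fun_prop), ← integral_const_mul]
  refine integral_congr_ae (Eventually.of_forall fun n => ?_)
  simp only [← Complex.exp_nat_mul]
  rw [← Complex.exp_sum, ← Complex.exp_add]
  congr 1
  have h1 : inner ℝ (localCoord p N (tableVec n)) t =
      -(∑ i, N * p i * (t i / √(p i) * (√N)⁻¹)) + ∑ i, n i * (t i / √(p i) * (√N)⁻¹) := by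
    rw [PiLp.inner_apply, ← Finset.sum_neg_distrib, ← Finset.sum_add_distrib]
    refine Finset.sum_congr rfl fun i _ => ?_
    simp only [localCoord_apply, RCLike.inner_apply, conj_trivial, tableVec]
    ring
  rw [h1]
  push_cast
  rw [add_mul, Finset.sum_mul _ _ Complex.I]
  congr 1
  refine Finset.sum_congr rfl fun i _ => ?_
  ring

theorem integral_law_poisson (m : Fin k → ℝ) (hm : ∀ i, 0 ≤ m i) (b : Fin k → ℝ) :
    ∫ n, ∏ i, Complex.exp ((b i : ℝ) * Complex.I) ^ n i ∂(poisson : SamplingPlan k).law m =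
      Complex.exp (∑ i, m i * (Complex.exp (b i * Complex.I) - 1)) := by
  unfold law
  rw [integral_fintype_prod_eq_prod
    (f := fun i (j : ℕ) => Complex.exp ((b i : ℝ) * Complex.I) ^ j), Complex.exp_sum]
  refine Finset.prod_congr rfl fun i _ => ?_
  rw [integral_pow_poissonMeasure]
  congr 2
  exact_mod_cast Real.coe_toNNReal _ (hm i)

theorem sum_mul_div_sq (hp : ∀ i, 0 < p i) (t : EuclideanSpace ℝ (Fin k)) :
    ∑ i, (p i : ℂ) * (-((t i / √(p i) : ℝ) : ℂ) ^ 2 / 2) = -(‖t‖ : ℂ) ^ 2 / 2 := by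
  rw [← Complex.ofReal_pow, EuclideanSpace.norm_sq_eq, Complex.ofReal_sum,
    ← Finset.sum_neg_distrib, Finset.sum_div]
  refine Finset.sum_congr rfl fun i _ => ?_
  have h1 : p i * (t i / √(p i)) ^ 2 = t i ^ 2 := by
    have := (hp i).ne'
    rw [div_pow, Real.sq_sqrt (hp i).le]
    field_simp
  rw [Real.norm_eq_abs, sq_abs, ← h1]
  push_cast
  ring

theorem tendsto_charFun_poisson (hp : ∀ i, 0 < p i) {N : ℕ → ℝ} (hN₀ : ∀ j, 0 < N j)
    (hN : Tendsto N atTop atTop) (t : EuclideanSpace ℝ (Fin k)) :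
    Tendsto (fun j => charFun (((poisson : SamplingPlan k).law (N j • p)).map
      fun n => localCoord p (N j) (tableVec n)) t) atTop (𝓝 (Complex.exp (-(‖t‖ : ℂ) ^ 2 / 2))) := by
  have h1 := tendsto_finsetSum Finset.univ fun i _ =>
    ((tendsto_cexp_second_order (t i / √(p i))).comp (tendsto_inv_sqrt hN)).const_mul (p i : ℂ)
  rw [sum_mul_div_sq hp] at h1
  refine ((Complex.continuous_exp.tendsto _).comp h1).congr fun j => ?_
  rw [charFun_map_localCoord, integral_law_poisson (N j • p) (fun i => (mul_pos (hN₀ j) (hp i)).le),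
    ← Complex.exp_add]
  simp only [Function.comp]
  congr 1
  push_cast
  rw [← Finset.sum_neg_distrib, Finset.sum_mul, ← Finset.sum_add_distrib]
  refine Finset.sum_congr rfl fun i _ => ?_
  have h2 : (((√(N j) : ℝ) : ℂ)⁻¹ ^ 2)⁻¹ = N j := by
    exact_mod_cast sqrt_inv_sq_inv (hN₀ j)
  rw [div_eq_mul_inv _ ((((√(N j) : ℝ) : ℂ)⁻¹) ^ 2), h2]
  simp only [Pi.smul_apply, smul_eq_mul]
  push_cast
  ring

/-- One multinomial subtable: (1 + g)^a tends to exp(lim a g). The condition ∑ q b = 0 kills the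
first-order term. An empty subtable has total 0 and contributes 1 on both sides. -/
theorem tendsto_subtable {ι : Type*} (s : Finset ι) {q b : ι → ℝ} (hq : ∀ i ∈ s, 0 < q i)
    (hqb : ∑ i ∈ s, q i * b i = 0) {N : ℕ → ℝ} (hN₀ : ∀ j, 0 < N j) (hN : Tendsto N atTop atTop)
    {a : ℕ → ℕ} (ha : ∀ j, ∑ i ∈ s, N j * q i = a j) :
    Tendsto (fun j => (∑ i ∈ s, (N j * q i / a j : ℝ) *
      Complex.exp ((b i * (√(N j))⁻¹ : ℝ) * Complex.I)) ^ a j) atTop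
      (𝓝 (Complex.exp (∑ i ∈ s, (q i : ℂ) * (-(b i : ℂ) ^ 2 / 2)))) := by
  rcases s.eq_empty_or_nonempty with rfl | hs
  · have : ∀ j, a j = 0 := fun j => by
      have := ha j
      rw [Finset.sum_empty] at this
      exact_mod_cast this.symm
    simp [this]
  set P := ∑ i ∈ s, q i with hP
  have hP0 : 0 < P := Finset.sum_pos hq hs
  have haP : ∀ j, (a j : ℝ) = N j * P := fun j => by rw [← ha j, hP, Finset.mul_sum]
  -- The real variable x stands for the subtable total N P, so that τ equals 1/√N there and the
  -- limit (1 + g(x))^x applies along x = `a j`.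
  set τ : ℝ → ℝ := fun x => √P * (√x)⁻¹ with hτ
  have hτ0 : Tendsto τ atTop (𝓝[>] 0) := by
    refine tendsto_nhdsWithin_iff.2 ⟨?_, ?_⟩
    · have := ((tendsto_inv_sqrt (tendsto_id (α := ℝ) (x := atTop))).mono_right
        nhdsWithin_le_nhds).const_mul √P
      simpa using this
    · filter_upwards [eventually_gt_atTop 0] with x hx
      exact mul_pos (Real.sqrt_pos.2 hP0) (inv_pos.2 (Real.sqrt_pos.2 hx))
  set g : ℝ → ℂ := fun x => ∑ i ∈ s, ((q i / P : ℝ) : ℂ) *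
    (Complex.exp ((b i * τ x : ℝ) * Complex.I) - 1 - (b i * τ x : ℝ) * Complex.I) with hg
  have h1 := tendsto_finsetSum s fun i _ =>
    ((tendsto_cexp_second_order (b i)).comp hτ0).const_mul (q i : ℂ)
  have h2 : Tendsto (fun x : ℝ => (x : ℂ) * g x) atTop
      (𝓝 (∑ i ∈ s, (q i : ℂ) * (-(b i : ℂ) ^ 2 / 2))) := by
    refine h1.congr' ?_
    filter_upwards [eventually_gt_atTop 0] with x hx
    rw [hg, Finset.mul_sum]
    refine Finset.sum_congr rfl fun i _ => ?_
    have hτx : ((τ x : ℝ) : ℂ) ^ 2 = P / x := by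
      have : τ x ^ 2 = P / x := by
        rw [hτ]
        simp only
        rw [mul_pow, inv_pow, Real.sq_sqrt hP0.le, Real.sq_sqrt hx.le, div_eq_mul_inv]
      exact_mod_cast this
    have hPc : (P : ℂ) ≠ 0 := by exact_mod_cast hP0.ne'
    have hxc : (x : ℂ) ≠ 0 := by exact_mod_cast hx.ne'
    simp only [Function.comp]
    rw [hτx]
    push_cast
    field_simp
  have h3 := Complex.tendsto_one_add_cpow_exp_of_tendsto h2
  have haT : Tendsto (fun j => (a j : ℝ)) atTop atTop := by
    simp only [haP]
    exact hN.atTop_mul_const hP0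
  refine (h3.comp haT).congr fun j => ?_
  simp only [Function.comp, Complex.ofReal_natCast, Complex.cpow_natCast]
  congr 1
  have hτj : τ (a j) = (√(N j))⁻¹ := by
    rw [hτ]
    simp only
    rw [haP, Real.sqrt_mul (hN₀ j).le]
    have := (Real.sqrt_pos.2 hP0).ne'
    field_simp
  have hc : ∀ i, N j * q i / (a j : ℝ) = q i / P := fun i => by
    have := (hN₀ j).ne'
    rw [haP]
    field_simp
  have hsum1 : ∑ i ∈ s, ((q i / P : ℝ) : ℂ) = 1 := by
    rw [← Complex.ofReal_sum, ← Finset.sum_div, ← hP, div_self hP0.ne', Complex.ofReal_one]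
  have hsum0 : ∑ i ∈ s, ((q i / P : ℝ) : ℂ) * ((b i * (√(N j))⁻¹ : ℝ) * Complex.I) = 0 := by
    have h4 : ∑ i ∈ s, ((q i / P : ℝ) : ℂ) * ((b i * (√(N j))⁻¹ : ℝ) * Complex.I) =
        ((∑ i ∈ s, q i * b i : ℝ) : ℂ) * (((√(N j))⁻¹ / P : ℝ) * Complex.I) := by
      rw [Complex.ofReal_sum, Finset.sum_mul]
      refine Finset.sum_congr rfl fun i _ => ?_
      push_cast
      ring
    rw [h4, hqb, Complex.ofReal_zero, zero_mul]
  rw [hg]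
  simp only [hτj, hc, mul_sub, Finset.sum_sub_distrib, mul_one, hsum1, hsum0]
  ring

theorem tendsto_charFun_productMultinomial {c : ℕ} {stratum : Fin k → Fin c} (hp : ∀ i, 0 < p i)
    {N : ℕ → ℝ} (hN₀ : ∀ j, 0 < N j) (hN : Tendsto N atTop atTop)
    (hadm : ∀ j, (productMultinomial c stratum).Admissible (N j • p))
    {t : EuclideanSpace ℝ (Fin k)}
    (ht : t ∈ (productMultinomial c stratum).fluctuationSpace p) :
    Tendsto (fun j => charFun (((productMultinomial c stratum).law (N j • p)).map
      fun n => localCoord p (N j) (tableVec n)) t) atTop (𝓝 (Complex.exp (-(‖t‖ : ℂ) ^ 2 / 2))) := by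
  choose a ha using fun j => (hadm j).exists_totals
  -- Membership of t in the fluctuation space, tested on the indicator of one subtable.
  have hstrat : ∀ h, ∑ i with stratum i = h, p i * (t i / √(p i)) = 0 := by
    intro h
    have h1 := (Submodule.mem_orthogonal _ _).1 ht
      (rootScale p ((productMultinomial c stratum).X0 *ᵥ Pi.single (M := fun _ : Fin c => ℝ) h 1))
      ⟨_, ⟨_, rfl⟩, rfl⟩
    rw [← h1, PiLp.inner_apply, Finset.sum_filter]
    refine Finset.sum_congr rfl fun i _ => ?_
    have h2 : ((productMultinomial c stratum).X0 *ᵥ Pi.single (M := fun _ : Fin c => ℝ) h 1) i =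
        if stratum i = h then 1 else 0 :=
      (congrFun (Matrix.mulVec_single_one (productMultinomial c stratum).X0 h) i).trans rfl
    rw [rootScale_apply, h2]
    have h3 := (Real.sqrt_pos.2 (hp i)).ne'
    have h4 := Real.mul_self_sqrt (hp i).le
    split_ifs
    · simp only [RCLike.inner_apply, conj_trivial]
      nth_rewrite 1 [← h4]
      field_simp
    · simp
  have hcenter : ∀ j, ∑ i, N j * p i * (t i / √(p i) * (√(N j))⁻¹) = 0 := by
    intro j
    have h1 : ∑ i, N j * p i * (t i / √(p i) * (√(N j))⁻¹) =
        (∑ i, p i * (t i / √(p i))) * (N j * (√(N j))⁻¹) := by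
      rw [Finset.sum_mul]
      refine Finset.sum_congr rfl fun i _ => ?_
      ring
    rw [h1, ← Finset.sum_fiberwise _ stratum, Finset.sum_congr rfl fun h _ => hstrat h]
    simp
  have h1 := tendsto_finsetProd Finset.univ fun h _ =>
    tendsto_subtable {i | stratum i = h} (fun i _ => hp i) (hstrat h) hN₀ hN (fun j => ha j h)
  rw [← Complex.exp_sum, Finset.sum_fiberwise _ stratum, sum_mul_div_sq hp] at h1
  refine h1.congr fun j => ?_
  rw [charFun_map_localCoord, hcenter, integral_law_productMultinomial stratum
    (m := N j • p) (fun i => (mul_pos (hN₀ j) (hp i)).le) (ha j)]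
  simp

/-- The central limit theorem for contingency tables, for characteristic functions. -/
theorem tendsto_charFun (S : SamplingPlan k) (hp : ∀ i, 0 < p i) {N : ℕ → ℝ}
    (hN₀ : ∀ j, 0 < N j) (hN : Tendsto N atTop atTop) (hadm : ∀ j, S.Admissible (N j • p))
    (t : EuclideanSpace ℝ (Fin k)) :
    Tendsto (fun j => charFun ((S.law (N j • p)).map fun n => localCoord p (N j) (tableVec n)) t)
      atTop (𝓝 (Complex.exp (-(‖(S.fluctuationSpace p).starProjection t‖ : ℂ) ^ 2 / 2))) := by
  -- The table lies almost surely in the fluctuation space, so only the projection of t matters.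
  have h1 : ∀ j, charFun ((S.law (N j • p)).map fun n => localCoord p (N j) (tableVec n)) t =
      charFun ((S.law (N j • p)).map fun n => localCoord p (N j) (tableVec n))
        ((S.fluctuationSpace p).starProjection t) := by
    intro j
    rw [charFun_apply, charFun_apply, integral_map .of_discrete (by fun_prop),
      integral_map .of_discrete (by fun_prop)]
    refine integral_congr_ae ?_
    filter_upwards [S.ae_localCoord_mem hp (hN₀ j) (hadm j)] with n hn
    rw [← Submodule.inner_starProjection_left_eq_right,
      Submodule.starProjection_eq_self_iff.2 hn]
  simp only [h1]
  have hmem := (S.fluctuationSpace p).starProjection_apply_mem t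
  cases S with
  | poisson => exact tendsto_charFun_poisson hp hN₀ hN _
  | productMultinomial c stratum =>
    exact tendsto_charFun_productMultinomial hp hN₀ hN hadm hmem

end SamplingPlan

/-! ### Continuity and quantiles of the chi-square distribution -/

section ChiSquare

instance isProbabilityMeasure_chiSq (d : ℕ) : IsProbabilityMeasure (chiSq d) :=
  Measure.isProbabilityMeasure_map (Measurable.aemeasurable (by fun_prop))

/-- By Fubini: once the other coordinates are fixed, the first one has at most two possible values,
a null set for a Gaussian. For d = 0 there would be an atom at 0. -/
theorem chiSq_singleton {d : ℕ} (hd : 0 < d) (x : ℝ) : chiSq d {x} = 0 := by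
  obtain ⟨d, rfl⟩ := Nat.exists_eq_add_of_lt hd
  rw [zero_add, chiSq, Measure.map_apply (by fun_prop) (measurableSet_singleton x)]
  have hmp := measurePreserving_piFinSuccAbove (fun _ : Fin (d + 1) => gaussianReal 0 1) 0
  set T : Set (ℝ × (Fin d → ℝ)) := {w | w.1 ^ 2 + ∑ i, w.2 i ^ 2 = x} with hT
  have hTm : MeasurableSet T := by
    have : Measurable fun w : ℝ × (Fin d → ℝ) => w.1 ^ 2 + ∑ i, w.2 i ^ 2 := by fun_prop
    exact this (measurableSet_singleton x)
  have hpre : (fun z : Fin (d + 1) → ℝ => ∑ i, z i ^ 2) ⁻¹' {x} =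
      MeasurableEquiv.piFinSuccAbove (fun _ : Fin (d + 1) => ℝ) 0 ⁻¹' T := by
    ext z
    simp only [Set.mem_preimage, Set.mem_singleton_iff, Fin.sum_univ_succ, hT]
    rfl
  rw [hpre, hmp.measure_preimage hTm.nullMeasurableSet, Measure.prod_apply_symm hTm]
  refine (lintegral_congr fun w => ?_).trans lintegral_zero
  have hfin : Set.Finite ((fun z : ℝ => (z, w)) ⁻¹' T) := by
    refine (Set.toFinite {√(x - ∑ i, w i ^ 2), -√(x - ∑ i, w i ^ 2)}).subset fun z hz => ?_
    have hz' : z ^ 2 = x - ∑ i, w i ^ 2 := eq_sub_of_add_eq hz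
    rw [← hz', Real.sqrt_sq_eq_abs]
    rcases abs_choice z with h | h <;> simp [h]
  have : NullSingletonClass (gaussianReal 0 1) :=
    nullSingletonClass_gaussianReal one_ne_zero
  exact hfin.measure_zero _

theorem continuous_cdf_of_singleton {ν : Measure ℝ} [IsProbabilityMeasure ν]
    (hν : ∀ x, ν {x} = 0) : Continuous (cdf ν) := by
  refine continuous_iff_continuousAt.2 fun x => continuousAt_iff_continuous_left'_right'.2 ⟨?_, ?_⟩
  · rw [(monotone_cdf ν).continuousWithinAt_Iio_iff_leftLim_eq]
    have h1 := (cdf ν).measure_singleton x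
    rw [measure_cdf, hν, eq_comm, ENNReal.ofReal_eq_zero] at h1
    exact le_antisymm ((monotone_cdf ν).leftLim_le le_rfl) (by linarith)
  · exact ((cdf ν).right_continuous x).mono Set.Ioi_subset_Ici_self

theorem chiSq_real_Iic_quantile {d : ℕ} (hd : 0 < d) {q : ℝ} (hq₀ : 0 < q) (hq₁ : q < 1) :
    (chiSq d).real (Set.Iic (chiSqQuantile d q)) = q := by
  have hc := continuous_cdf_of_singleton (chiSq_singleton hd)
  have hbot := (tendsto_cdf_atBot (chiSq d)).eventually (gt_mem_nhds hq₀)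
  have htop := (tendsto_cdf_atTop (chiSq d)).eventually (lt_mem_nhds hq₁)
  obtain ⟨x₀, hx₀⟩ := hbot.exists
  obtain ⟨x₁, hx₁⟩ := htop.exists
  obtain ⟨x, hx⟩ := mem_range_of_exists_le_of_exists_ge hc ⟨x₀, hx₀.le⟩ ⟨x₁, hx₁.le⟩
  set T : Set ℝ := {x | q ≤ cdf (chiSq d) x} with hT
  have hquant : chiSqQuantile d q = sInf T := by
    simp only [chiSqQuantile, hT, cdf_eq_real]
  have hbdd : BddBelow T := by
    refine ⟨x₀, fun y hy => ?_⟩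
    by_contra hlt
    have h1 := monotone_cdf (chiSq d) (not_le.1 hlt).le
    have h2 : q ≤ cdf (chiSq d) y := hy
    linarith
  have hxT : x ∈ T := hx.ge
  rw [hquant, ← cdf_eq_real]
  refine le_antisymm ?_ ?_
  · rw [← hx]
    exact monotone_cdf _ (csInf_le hbdd hxT)
  · exact (isClosed_le continuous_const hc).csInf_mem ⟨x, hxT⟩ hbdd

end ChiSquare

/-! ### Projections of standard Gaussian vectors -/

section Gaussian

variable {E : Type*} [NormedAddCommGroup E] [InnerProductSpace ℝ E] [FiniteDimensional ℝ E]
  [MeasurableSpace E] [BorelSpace E]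

theorem stdGaussian_map_orthogonalProjectionOnto (U : Submodule ℝ E) :
    (stdGaussian E).map U.orthogonalProjectionOnto = stdGaussian U := by
  apply Measure.ext_of_charFun
  ext u
  rw [charFun_stdGaussian, charFun_apply, integral_map (by fun_prop) (by fun_prop)]
  simp only [Submodule.inner_orthogonalProjectionOnto_eq_of_mem_right]
  rw [← charFun_apply, charFun_stdGaussian]
  rfl

theorem stdGaussian_map_normSq : (stdGaussian E).map (fun x => ‖x‖ ^ 2) =
    chiSq (Module.finrank ℝ E) := by
  rw [stdGaussian, Measure.map_map (by fun_prop) (by fun_prop), chiSq]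
  congr 1
  ext x
  simp only [Function.comp]
  rw [← (stdOrthonormalBasis ℝ E).sum_sq_norm_inner_right]
  refine Finset.sum_congr rfl fun i _ => ?_
  rw [inner_sum, Finset.sum_eq_single i]
  · simp [inner_smul_right]
  · intro j _ hj
    simp [inner_smul_right, (stdOrthonormalBasis ℝ E).inner_eq_zero hj.symm]
  · simp

theorem stdGaussian_map_starProjection_normSq (U : Submodule ℝ E) :
    (stdGaussian E).map (fun x => ‖U.starProjection x‖ ^ 2) = chiSq (Module.finrank ℝ U) := by
  rw [← stdGaussian_map_normSq, ← stdGaussian_map_orthogonalProjectionOnto,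
    Measure.map_map (by fun_prop) (by fun_prop)]
  rfl

/-- The projections of a standard Gaussian vector onto orthogonal subspaces are independent. -/
theorem iIndepFun_starProjection_stdGaussian {ι : Type*} [Fintype ι] {U : ι → Submodule ℝ E}
    (hU : Pairwise fun i j => U i ⟂ U j) :
    iIndepFun (fun i x => (U i).starProjection x) (stdGaussian E) := by
  rw [iIndepFun_iff_charFun_pi (fun i => by fun_prop)]
  intro t
  have h1 : ∀ i, charFun ((stdGaussian E).map fun x => (U i).starProjection x) (t i) =
      Complex.exp (-‖(U i).starProjection (t i)‖ ^ 2 / 2) := by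
    intro i
    rw [charFun_apply, integral_map (by fun_prop) (by fun_prop)]
    simp only [Submodule.inner_starProjection_left_eq_right]
    rw [← charFun_apply, charFun_stdGaussian]
  have h2 : charFun ((stdGaussian E).map fun x => WithLp.toLp 2 fun i => (U i).starProjection x) t =
      Complex.exp (-‖∑ i, (U i).starProjection (t i)‖ ^ 2 / 2) := by
    rw [charFun_apply, integral_map (by fun_prop) (by fun_prop)]
    simp only [PiLp.inner_apply, Submodule.inner_starProjection_left_eq_right]
    simp only [← inner_sum]
    rw [← charFun_apply, charFun_stdGaussian]
  rw [h2, Finset.prod_congr rfl fun i _ => h1 i, ← Complex.exp_sum]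
  congr 1
  have h3 : ‖∑ i, (U i).starProjection (t i)‖ ^ 2 = ∑ i, ‖(U i).starProjection (t i)‖ ^ 2 := by
    rw [← real_inner_self_eq_norm_sq, sum_inner]
    refine Finset.sum_congr rfl fun i _ => ?_
    rw [inner_sum, Finset.sum_eq_single i, real_inner_self_eq_norm_sq]
    · intro j _ hj
      exact (hU hj.symm).inner_eq (Submodule.starProjection_apply_mem _ _)
        (Submodule.starProjection_apply_mem _ _)
    · simp
  rw [← Complex.ofReal_pow, h3]
  push_cast
  rw [← Finset.sum_neg_distrib, Finset.sum_div]

/-- The joint distribution function of squared norms of projections onto orthogonal subspaces. -/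
theorem stdGaussian_real_forall_normSq_le {ι : Type*} [Fintype ι] {U : ι → Submodule ℝ E}
    (hU : Pairwise fun i j => U i ⟂ U j) (r : ι → ℝ) :
    (stdGaussian E).real {x | ∀ i, ‖(U i).starProjection x‖ ^ 2 ≤ r i} =
      ∏ i, (chiSq (Module.finrank ℝ (U i))).real (Set.Iic (r i)) := by
  have hmeas : ∀ i, MeasurableSet {v : E | ‖v‖ ^ 2 ≤ r i} := fun i =>
    measurableSet_le (by fun_prop) measurable_const
  have h1 := (iIndepFun_starProjection_stdGaussian hU).measure_inter_preimage_eq_mul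
    Finset.univ (sets := fun i => {v : E | ‖v‖ ^ 2 ≤ r i}) fun i _ => hmeas i
  have h2 : {x : E | ∀ i, ‖(U i).starProjection x‖ ^ 2 ≤ r i} =
      ⋂ i ∈ Finset.univ, (fun x => (U i).starProjection x) ⁻¹' {v : E | ‖v‖ ^ 2 ≤ r i} := by
    ext x
    simp
  rw [measureReal_def, h2, h1, ENNReal.toReal_prod]
  refine Finset.prod_congr rfl fun i _ => ?_
  rw [← stdGaussian_map_starProjection_normSq, measureReal_def,
    Measure.map_apply (by fun_prop) measurableSet_Iic]
  rfl

end Gaussian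

/-! ### From approximation of the statistics to limits of rejection probabilities -/

/-- If events `R j` are asymptotically determined, on bounded sets, by the sign of a continuous
function `Q` of variables `Y j` that converge in distribution, their probabilities converge. -/
theorem tendsto_measureReal_of_approx {Ω E : Type*} [MeasurableSpace Ω] [NormedAddCommGroup E]
    [MeasurableSpace E] [BorelSpace E] {μ : ℕ → Measure Ω} [∀ j, IsProbabilityMeasure (μ j)]
    {Y : ℕ → Ω → E} (hY : ∀ j, Measurable (Y j)) {γ : ProbabilityMeasure E}
    {ν : ℕ → ProbabilityMeasure E} (hν : ∀ j, (ν j : Measure E) = (μ j).map (Y j))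
    (hlim : Tendsto ν atTop (𝓝 γ)) {Q : E → ℝ} (hQ : Continuous Q)
    (hQ0 : (γ : Measure E) {y | Q y = 0} = 0) {R : ℕ → Set Ω}
    (hR : ∀ K ε : ℝ, 0 < ε → ∀ᶠ j in atTop, ∀ᵐ n ∂μ j, ‖Y j n‖ ≤ K →
      (n ∈ R j → -ε < Q (Y j n)) ∧ (ε < Q (Y j n) → n ∈ R j)) :
    Tendsto (fun j => μ j (R j)) atTop (𝓝 ((γ : Measure E) {y | 0 < Q y})) := by
  set e : ℕ → ℝ := fun m => 1 / ((m : ℝ) + 1) with he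
  have he0 : ∀ m, 0 < e m := fun m => by positivity
  -- The set where the approximation does not decide: too close to the boundary Q = 0, or too far
  -- out. These sets decrease into {Q = 0}, and the two halves of the portmanteau theorem give the
  -- limit up to their mass.
  set D : ℕ → Set E := fun m => {y | |Q y| ≤ e m} ∪ {y | (m : ℝ) ≤ ‖y‖} with hD
  have hDm : ∀ m, MeasurableSet (D m) := fun m =>
    ((isClosed_le hQ.abs continuous_const).union
      (isClosed_le continuous_const continuous_norm)).measurableSet
  have hDanti : Antitone D := by
    intro m m' hmm y hy
    have hcast : (m : ℝ) ≤ m' := by exact_mod_cast hmm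
    rcases hy with hy | hy
    · refine Or.inl (show |Q y| ≤ e m from le_trans hy ?_)
      simp only [he]
      gcongr
    · exact Or.inr (hcast.trans hy)
  have hDlim : Tendsto (fun m => (γ : Measure E) (D m)) atTop (𝓝 0) := by
    have h1 := tendsto_measure_iInter_atTop (μ := (γ : Measure E))
      (fun m => (hDm m).nullMeasurableSet) hDanti ⟨0, measure_ne_top _ _⟩
    convert! h1 using 2
    refine (measure_mono_null (fun y hy => ?_) hQ0).symm
    by_contra hne
    have hpos : 0 < |Q y| := abs_pos.2 hne
    obtain ⟨m₁, hm₁⟩ := exists_nat_one_div_lt hpos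
    obtain ⟨m₂, hm₂⟩ := exists_nat_gt ‖y‖
    have hy' := Set.mem_iInter.1 hy (max m₁ m₂)
    rcases hy' with h2 | h2
    · have h3 : e (max m₁ m₂) ≤ e m₁ := by
        simp only [he]
        gcongr
        exact_mod_cast le_max_left m₁ m₂
      have h4 : |Q y| ≤ e (max m₁ m₂) := h2
      have h5 : e m₁ < |Q y| := hm₁
      linarith
    · have h3 : ((max m₁ m₂ : ℕ) : ℝ) ≤ ‖y‖ := h2
      have h4 : (m₂ : ℝ) ≤ (max m₁ m₂ : ℕ) := by exact_mod_cast le_max_right m₁ m₂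
      linarith
  set P := (γ : Measure E) {y | 0 < Q y} with hP
  have hup : ∀ m : ℕ, limsup (fun j => μ j (R j)) atTop ≤ P + (γ : Measure E) (D m) := by
    intro m
    set F : Set E := {y | -e m ≤ Q y} ∪ {y | (m : ℝ) ≤ ‖y‖} with hF
    have hFc : IsClosed F := (isClosed_le continuous_const hQ).union
      (isClosed_le continuous_const continuous_norm)
    have h1 := ProbabilityMeasure.limsup_measure_closed_le_of_tendsto hlim hFc
    have h2 : (γ : Measure E) F ≤ P + (γ : Measure E) (D m) := by
      refine (measure_mono fun y hy => ?_).trans (measure_union_le _ _)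
      rcases hy with hy | hy
      · by_cases h0 : 0 < Q y
        · exact Or.inl h0
        · exact Or.inr (Or.inl (show |Q y| ≤ e m from
            abs_le.2 ⟨hy, (not_lt.1 h0).trans (he0 m).le⟩))
      · exact Or.inr (Or.inr hy)
    refine le_trans ?_ (h1.trans h2)
    refine limsup_le_limsup ?_
    filter_upwards [hR m (e m) (he0 m)] with j hj
    rw [hν j, Measure.map_apply (hY j) hFc.measurableSet]
    refine measure_mono_ae ?_
    filter_upwards [hj] with n hn hnR
    by_cases hK : ‖Y j n‖ ≤ m
    · exact Or.inl ((hn hK).1 hnR).le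
    · exact Or.inr (not_le.1 hK).le
  have hlow : ∀ m : ℕ, P - (γ : Measure E) (D m) ≤ liminf (fun j => μ j (R j)) atTop := by
    intro m
    set G : Set E := {y | e m < Q y} ∩ {y | ‖y‖ < m} with hG
    have hGo : IsOpen G := (isOpen_lt continuous_const hQ).inter
      (isOpen_lt continuous_norm continuous_const)
    have h1 := ProbabilityMeasure.le_liminf_measure_open_of_tendsto hlim hGo
    have h2 : P - (γ : Measure E) (D m) ≤ (γ : Measure E) G := by
      rw [tsub_le_iff_right]
      refine (measure_mono fun y hy => ?_).trans (measure_union_le _ _)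
      by_cases hyD : y ∈ D m
      · exact Or.inr hyD
      · simp only [hD, Set.mem_union, Set.mem_ofPred_eq, not_or, not_le] at hyD
        rw [abs_of_pos hy] at hyD
        exact Or.inl hyD
    refine h2.trans (h1.trans ?_)
    refine liminf_le_liminf ?_
    filter_upwards [hR m (e m) (he0 m)] with j hj
    rw [hν j, Measure.map_apply (hY j) hGo.measurableSet]
    refine measure_mono_ae ?_
    filter_upwards [hj] with n hn hnG
    exact (hn (le_of_lt hnG.2)).2 hnG.1
  refine tendsto_of_le_liminf_of_limsup_le ?_ ?_
  · have h1 : Tendsto (fun m => P - (γ : Measure E) (D m)) atTop (𝓝 (P - 0)) :=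
      ENNReal.Tendsto.sub tendsto_const_nhds hDlim (Or.inl (measure_ne_top _ _))
    rw [tsub_zero] at h1
    exact le_of_tendsto' h1 hlow
  · have h1 : Tendsto (fun m => P + (γ : Measure E) (D m)) atTop (𝓝 (P + 0)) :=
      tendsto_const_nhds.add hDlim
    rw [add_zero] at h1
    exact ge_of_tendsto' h1 hup

section Limit

variable {k : ℕ} {S : SamplingPlan k} {p : Fin k → ℝ}

theorem starProjection_sub_of_le {E : Type*} [NormedAddCommGroup E] [InnerProductSpace ℝ E]
    [FiniteDimensional ℝ E] {W W' : Submodule ℝ E} (h : W' ≤ W) (x : E) :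
    W.starProjection x - W'.starProjection x = (W ⊓ W'ᗮ).starProjection x := by
  refine (Submodule.eq_starProjection_of_mem_orthogonal
    (Submodule.mem_inf.2 ⟨?_, ?_⟩) ?_).symm
  · exact W.sub_mem (W.starProjection_apply_mem x) (h (W'.starProjection_apply_mem x))
  · have h1 : W.starProjection x - W'.starProjection x =
        (x - W'.starProjection x) - (x - W.starProjection x) := by abel
    rw [h1]
    exact Submodule.sub_mem _ (Submodule.sub_starProjection_mem_orthogonal x)
      (Submodule.orthogonal_le h (Submodule.sub_starProjection_mem_orthogonal x))
  · have h1 : x - (W.starProjection x - W'.starProjection x) =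
        (x - W.starProjection x) + W'.starProjection x := by abel
    rw [h1]
    refine Submodule.add_mem _ (Submodule.orthogonal_le inf_le_left
      (Submodule.sub_starProjection_mem_orthogonal x)) ?_
    refine Submodule.orthogonal_le (inf_le_right (a := W)) ?_
    rw [Submodule.orthogonal_orthogonal]
    exact W'.starProjection_apply_mem x

namespace LMLC

theorem tangentSpace_le_fluctuationSpace (M : LMLC S) :
    M.tangentSpace p ≤ S.fluctuationSpace p := by
  refine inf_le_right.trans (Submodule.orthogonal_le (Submodule.map_mono ?_))
  rintro _ ⟨x, rfl⟩
  refine ⟨Sum.elim x 0, ?_⟩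
  simp only [L, Matrix.mulVecLin_apply, Matrix.fromCols_mulVec_sumElim, Matrix.mulVec_zero,
    add_zero]

theorem NestedWithin.testForm_starProjection {M' M : LMLC S} (h : M'.NestedWithin M)
    (x : EuclideanSpace ℝ (Fin k)) :
    testForm M' M p ((S.fluctuationSpace p).starProjection x) =
      ‖(M.tangentSpace p ⊓ (M'.tangentSpace p)ᗮ).starProjection x‖ ^ 2 := by
  have h1 : ∀ M : LMLC S, (M.tangentSpace p).starProjection
      ((S.fluctuationSpace p).starProjection x) = (M.tangentSpace p).starProjection x := fun M =>
    congrArg (fun f => f x)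
      (Submodule.starProjection_comp_starProjection_of_le M.tangentSpace_le_fluctuationSpace)
  rw [testForm, h1, h1, starProjection_sub_of_le h.tangentSpace_le]

theorem inf_eq_bot_of_chain {a e : ℕ} {M : ℕ → LMLC S}
    (hM : ∀ b, a ≤ b → b < e → NestedWithin (M (b + 1)) (M b)) (hp : ∀ i, 0 < p i)
    (hreg : (M e).RegularAt p) (b : ℕ) (hab : a ≤ b) (hbe : b ≤ e) :
    (M b).constraintSpace p ⊓ ((M b).logSpace p)ᗮ = ⊥ := by
  induction hbe using Nat.decreasingInduction with
  | self => exact hreg.inf_eq_bot hp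
  | of_succ b hbe ih => exact (hM b hab hbe).inf_eq_bot (ih (by omega))

end LMLC

theorem continuous_testForm (M' M : LMLC S) (p : Fin k → ℝ) : Continuous (testForm M' M p) := by
  unfold testForm
  fun_prop

/-- The law of the limit of the local coordinates of the table. -/
noncomputable def limitLaw (S : SamplingPlan k) (p : Fin k → ℝ) :
    ProbabilityMeasure (EuclideanSpace ℝ (Fin k)) :=
  ⟨(stdGaussian (EuclideanSpace ℝ (Fin k))).map (S.fluctuationSpace p).starProjection,
    Measure.isProbabilityMeasure_map (by fun_prop)⟩

theorem charFun_limitLaw (S : SamplingPlan k) (p : Fin k → ℝ) (t : EuclideanSpace ℝ (Fin k)) :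
    charFun (limitLaw S p : Measure (EuclideanSpace ℝ (Fin k))) t =
      Complex.exp (-(‖(S.fluctuationSpace p).starProjection t‖ : ℂ) ^ 2 / 2) := by
  change charFun ((stdGaussian (EuclideanSpace ℝ (Fin k))).map
    (S.fluctuationSpace p).starProjection) t = _
  rw [charFun_apply, integral_map (by fun_prop) (by fun_prop)]
  simp only [Submodule.inner_starProjection_left_eq_right]
  rw [← charFun_apply, charFun_stdGaussian]

/-- Probability that at least one of the tests for a chain of nested models rejects. -/
theorem tendsto_rejection_probability {a e : ℕ} (hae : a < e) (M : ℕ → LMLC S)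
    (hM : ∀ b, a ≤ b → b < e → LMLC.NestedWithin (M (b + 1)) (M b)) {N : ℕ → ℝ}
    (hN₀ : ∀ j, 0 < N j) (hN : Tendsto N atTop atTop) (hp : ∀ i, 0 < p i)
    (hadm : ∀ j, S.Admissible (N j • p)) (hreg : (M e).RegularAt p) {q : ℝ} (hq₀ : 0 < q)
    (hq₁ : q < 1) (stat : ℕ → ℕ → (Fin k → ℕ) → EReal)
    (hstat : ∀ b, a ≤ b → b < e → ∀ K ε : ℝ, 0 < ε → ∀ᶠ j in atTop, ∀ n : Fin k → ℕ,
      ‖localCoord p (N j) (tableVec n)‖ ≤ K → S.X0ᵀ *ᵥ tableVec n = S.X0ᵀ *ᵥ (N j • p) →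
      ∃ f : ℝ, stat j b n = f ∧
        |f - testForm (M (b + 1)) (M b) p (localCoord p (N j) (tableVec n))| < ε) :
    Tendsto (fun j => (S.law (N j • p)).real {n | ∃ b, a ≤ b ∧ b < e ∧
      (chiSqQuantile (LMLC.df (M (b + 1)) (M b)) q : EReal) < stat j b n}) atTop
      (𝓝 (1 - q ^ (e - a))) := by
  have hprob : ∀ j, IsProbabilityMeasure (S.law (N j • p)) := fun j =>
    S.isProbabilityMeasure_law (fun i => (mul_pos (hN₀ j) (hp i)).le) (hadm j)
  set c : ℕ → ℝ := fun b => chiSqQuantile (LMLC.df (M (b + 1)) (M b)) q with hc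
  set U : ℕ → Submodule ℝ (EuclideanSpace ℝ (Fin k)) :=
    fun b => (M b).tangentSpace p ⊓ ((M (b + 1)).tangentSpace p)ᗮ with hU
  have hregs := LMLC.inf_eq_bot_of_chain hM hp hreg
  have hfin : ∀ b, a ≤ b → b < e → Module.finrank ℝ (U b) = LMLC.df (M (b + 1)) (M b) :=
    fun b hab hbe => (hM b hab hbe).finrank_inf_orthogonal hp
      (hregs (b + 1) (by omega) (by omega))
  have hanti : ∀ b, a ≤ b → ∀ b', b ≤ b' → b' ≤ e →
      (M b').tangentSpace p ≤ (M b).tangentSpace p := by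
    intro b hab b' hbb'
    induction b', hbb' using Nat.le_induction with
    | base => exact fun _ => le_rfl
    | succ b' hbb' ih =>
      exact fun hb' => (hM b' (by omega) (by omega)).tangentSpace_le.trans (ih (by omega))
  have horth : Pairwise fun i j : Finset.Ico a e => U i ⟂ U j := by
    have hlt : ∀ b b', a ≤ b → b < b' → b' < e → U b ⟂ U b' := by
      intro b b' hab hbb' hb'
      rw [Submodule.isOrtho_iff_le]
      refine inf_le_right.trans (Submodule.orthogonal_le (inf_le_left.trans ?_))
      exact hanti (b + 1) (by omega) b' hbb' hb'.le
    intro i j hij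
    have hi := Finset.mem_Ico.1 i.2
    have hj := Finset.mem_Ico.1 j.2
    rcases lt_or_gt_of_ne (fun h => hij (Subtype.ext h) : (i : ℕ) ≠ j) with h | h
    · exact hlt i j hi.1 h hj.2
    · exact (hlt j i hj.1 h hi.2).symm
  have hne : (Finset.Ico a e).Nonempty := Finset.nonempty_Ico.2 hae
  -- Some test rejects, in the limit, exactly when this maximum is positive.
  set Q : EuclideanSpace ℝ (Fin k) → ℝ := fun y =>
    (Finset.Ico a e).sup' hne fun b => testForm (M (b + 1)) (M b) p y - c b with hQ
  have hQc : Continuous Q := Continuous.finset_sup'_apply hne fun b _ =>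
    (continuous_testForm _ _ p).sub continuous_const
  have hform : ∀ b ∈ Finset.Ico a e, ∀ x, testForm (M (b + 1)) (M b) p
      ((S.fluctuationSpace p).starProjection x) = ‖(U b).starProjection x‖ ^ 2 := fun b hb x =>
    (hM b (Finset.mem_Ico.1 hb).1 (Finset.mem_Ico.1 hb).2).testForm_starProjection x
  have hmap : ∀ T : Set (EuclideanSpace ℝ (Fin k)), MeasurableSet T →
      (limitLaw S p : Measure (EuclideanSpace ℝ (Fin k))) T =
      stdGaussian (EuclideanSpace ℝ (Fin k)) ((S.fluctuationSpace p).starProjection ⁻¹' T) :=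
    fun T hT => Measure.map_apply (by fun_prop) hT
  -- On this set some chi-square limit equals its cutpoint. That is a null event because strict
  -- nesting gives positive degrees of freedom.
  have hQ0 : (limitLaw S p : Measure (EuclideanSpace ℝ (Fin k))) {y | Q y = 0} = 0 := by
    rw [hmap _ (isClosed_eq hQc continuous_const).measurableSet]
    refine measure_mono_null (t := ⋃ b ∈ Finset.Ico a e,
      (fun x => ‖(U b).starProjection x‖ ^ 2) ⁻¹' {c b}) (fun x hx => ?_) ?_
    · have hx' : Q ((S.fluctuationSpace p).starProjection x) = 0 := hx
      obtain ⟨b, hb, hbQ⟩ := Finset.exists_mem_eq_sup' hne fun b =>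
        testForm (M (b + 1)) (M b) p ((S.fluctuationSpace p).starProjection x) - c b
      have h1 := hbQ.symm.trans hx'
      rw [hform b hb, sub_eq_zero] at h1
      exact Set.mem_biUnion hb h1
    · refine (measure_biUnion_null_iff (Finset.countable_toSet _)).2 fun b hb => ?_
      have hb' := Finset.mem_Ico.1 (Finset.mem_coe.1 hb)
      rw [← Measure.map_apply (by fun_prop) (measurableSet_singleton _),
        stdGaussian_map_starProjection_normSq, hfin b hb'.1 hb'.2]
      exact chiSq_singleton (hM b hb'.1 hb'.2).df_pos _
  have hval : ((limitLaw S p : Measure (EuclideanSpace ℝ (Fin k))) {y | 0 < Q y}).toReal =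
      1 - q ^ (e - a) := by
    rw [hmap _ (isOpen_lt continuous_const hQc).measurableSet]
    have h1 : (S.fluctuationSpace p).starProjection ⁻¹' {y | 0 < Q y} =
        {x | ∀ i : Finset.Ico a e, ‖(U i).starProjection x‖ ^ 2 ≤ c i}ᶜ := by
      ext x
      have h2 : 0 < Q ((S.fluctuationSpace p).starProjection x) ↔
          ∃ b ∈ Finset.Ico a e, c b < ‖(U b).starProjection x‖ ^ 2 := by
        rw [hQ, Finset.lt_sup'_iff]
        refine exists_congr fun b => and_congr_right fun hb => ?_
        rw [hform b hb, sub_pos]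
      refine h2.trans ?_
      rw [Set.mem_compl_iff, Set.mem_ofPred_eq, not_forall]
      exact ⟨fun ⟨b, hb, h⟩ => ⟨⟨b, hb⟩, not_le.2 h⟩, fun ⟨i, h⟩ => ⟨i, i.2, not_le.1 h⟩⟩
    have hmeas : MeasurableSet {x : EuclideanSpace ℝ (Fin k) |
        ∀ i : Finset.Ico a e, ‖(U i).starProjection x‖ ^ 2 ≤ c i} := by
      rw [Set.ofPred_forall]
      exact MeasurableSet.iInter fun i => measurableSet_le (by fun_prop) measurable_const
    rw [h1, ← measureReal_def, probReal_compl_eq_one_sub hmeas,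
      stdGaussian_real_forall_normSq_le horth fun i => c i]
    congr 1
    have h3 : ∀ i : Finset.Ico a e,
        (chiSq (Module.finrank ℝ (U i))).real (Set.Iic (c i)) = q := by
      intro i
      have hi := Finset.mem_Ico.1 i.2
      rw [hfin i hi.1 hi.2]
      exact chiSq_real_Iic_quantile (hM i hi.1 hi.2).df_pos hq₀ hq₁
    simp [h3]
  set ν : ℕ → ProbabilityMeasure (EuclideanSpace ℝ (Fin k)) := fun j =>
    ⟨(S.law (N j • p)).map fun n => localCoord p (N j) (tableVec n),
      Measure.isProbabilityMeasure_map .of_discrete⟩ with hν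
  have hlim : Tendsto ν atTop (𝓝 (limitLaw S p)) := by
    refine ProbabilityMeasure.tendsto_of_tendsto_charFun fun t => ?_
    rw [charFun_limitLaw]
    exact S.tendsto_charFun hp hN₀ hN hadm t
  rw [← hval]
  refine (ENNReal.tendsto_toReal (measure_ne_top _ _)).comp ?_
  refine tendsto_measureReal_of_approx (Y := fun j n => localCoord p (N j) (tableVec n))
    (fun j => .of_discrete) (fun j => rfl) hlim hQc hQ0 fun K ε hε => ?_
  have hall : ∀ᶠ j in atTop, ∀ b ∈ Finset.Ico a e, ∀ n : Fin k → ℕ,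
      ‖localCoord p (N j) (tableVec n)‖ ≤ K → S.X0ᵀ *ᵥ tableVec n = S.X0ᵀ *ᵥ (N j • p) →
      ∃ f : ℝ, stat j b n = f ∧
        |f - testForm (M (b + 1)) (M b) p (localCoord p (N j) (tableVec n))| < ε :=
    (Finset.eventually_all _).2 fun b hb =>
      hstat b (Finset.mem_Ico.1 hb).1 (Finset.mem_Ico.1 hb).2 K ε hε
  filter_upwards [hall] with j hj
  filter_upwards [S.ae_totals (hadm j)] with n hn hnK
  constructor
  · rintro ⟨b, hab, hbe, hlt⟩
    have hb := Finset.mem_Ico.2 ⟨hab, hbe⟩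
    obtain ⟨f, hf, hfε⟩ := hj b hb n hnK hn
    rw [hf, EReal.coe_lt_coe_iff] at hlt
    refine (Finset.lt_sup'_iff _).2 ⟨b, hb, ?_⟩
    have := (abs_lt.1 hfε).2
    simp only [hc]
    linarith
  · intro hε'
    obtain ⟨b, hb, hlt⟩ := (Finset.lt_sup'_iff _).1 hε'
    obtain ⟨f, hf, hfε⟩ := hj b hb n hnK hn
    refine ⟨b, (Finset.mem_Ico.1 hb).1, (Finset.mem_Ico.1 hb).2, ?_⟩
    rw [hf, EReal.coe_lt_coe_iff]
    have := (abs_lt.1 hfε).1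
    simp only [hc] at hlt
    linarith

/-- Approximation along all sequences of tables with bounded local coordinates is uniform. -/
theorem eventually_forall_of_approx {N : ℕ → ℝ} {stat : ℕ → (Fin k → ℕ) → EReal}
    {Q : EuclideanSpace ℝ (Fin k) → ℝ} {K : ℝ}
    (h : ∀ l : Filter (ℕ × (Fin k → ℕ)), l ≤ comap Prod.fst atTop →
      ((fun w : ℕ × (Fin k → ℕ) => localCoord p (N w.1) (tableVec w.2)) =O[l] fun _ => (1 : ℝ)) →
      (∀ᶠ w in l, S.X0ᵀ *ᵥ tableVec w.2 = S.X0ᵀ *ᵥ (N w.1 • p)) →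
      ∃ f : ℕ × (Fin k → ℕ) → ℝ, (∀ᶠ w in l, stat w.1 w.2 = f w) ∧
        Tendsto (fun w => f w - Q (localCoord p (N w.1) (tableVec w.2))) l (𝓝 0))
    {ε : ℝ} (hε : 0 < ε) :
    ∀ᶠ j in atTop, ∀ n : Fin k → ℕ, ‖localCoord p (N j) (tableVec n)‖ ≤ K →
      S.X0ᵀ *ᵥ tableVec n = S.X0ᵀ *ᵥ (N j • p) →
      ∃ f : ℝ, stat j n = f ∧ |f - Q (localCoord p (N j) (tableVec n))| < ε := by
  -- Along the filter on pairs (j, table) that only sends j to infinity and stays in `T`, a limit is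
  -- automatically uniform over the tables. This is why the approximations are stated for arbitrary
  -- filters.
  set T : Set (ℕ × (Fin k → ℕ)) := {w | ‖localCoord p (N w.1) (tableVec w.2)‖ ≤ K ∧
    S.X0ᵀ *ᵥ tableVec w.2 = S.X0ᵀ *ᵥ (N w.1 • p)} with hT
  have hTl : ∀ᶠ w in comap Prod.fst atTop ⊓ 𝓟 T, w ∈ T :=
    (eventually_principal.2 fun _ h => h).filter_mono inf_le_right
  obtain ⟨f, hf, hlim⟩ := h (comap Prod.fst atTop ⊓ 𝓟 T) inf_le_left
    (Asymptotics.IsBigO.of_bound K (hTl.mono fun w hw => by simpa using hw.1))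
    (hTl.mono fun w hw => hw.2)
  have h1 := hf.and (hlim.eventually (Metric.ball_mem_nhds 0 hε))
  rw [eventually_inf_principal, eventually_comap] at h1
  filter_upwards [h1] with j hj n hnK hn
  obtain ⟨h2, h3⟩ := hj (j, n) rfl ⟨hnK, hn⟩
  exact ⟨f (j, n), h2, by simpa using h3⟩

end Limit

/-! ### Asymptotic sizes of the tests -/

/-- Both sequences of tests for a chain of nested models which all hold. -/
theorem tendsto_rejection_statT_statS {k : ℕ} {S : SamplingPlan k} {p : Fin k → ℝ} {a e : ℕ}
    (hae : a < e) (M : ℕ → LMLC S)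
    (hM : ∀ b, a ≤ b → b < e → LMLC.NestedWithin (M (b + 1)) (M b))
    {φ₁ φ₂ : ℝ → EReal} (hφ₁ : IsPhi φ₁) (hφ₂ : IsPhi φ₂) {N : ℕ → ℝ}
    (hN₀ : ∀ j, 0 < N j) (hN : Tendsto N atTop atTop)
    {est : ℕ → (b : ℕ) → (Fin k → ℕ) → Fin (M b).t → ℝ}
    (hest : ∀ j b, a ≤ b → b ≤ e → IsMinPhiEstimator (M b) φ₂ (N j) (est j b))
    (hadm : ∀ j, S.Admissible (N j • p))
    (hholds : ∀ b, a ≤ b → b ≤ e → ∀ j, (M b).Holds (N j) (N j • p))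
    (hreg : (M e).RegularAt p) {q : ℝ} (hq₀ : 0 < q) (hq₁ : q < 1) :
    Tendsto (fun j => (S.law (N j • p)).real {n | ∃ b, a ≤ b ∧ b < e ∧
        (chiSqQuantile (LMLC.df (M (b + 1)) (M b)) q : EReal) <
          statT (M (b + 1)) (M b) φ₁ (est j (b + 1) n) (est j b n)})
      atTop (𝓝 (1 - q ^ (e - a))) ∧
    Tendsto (fun j => (S.law (N j • p)).real {n | ∃ b, a ≤ b ∧ b < e ∧
        (chiSqQuantile (LMLC.df (M (b + 1)) (M b)) q : EReal) <
          statS (M (b + 1)) (M b) φ₂ n (est j (b + 1) n) (est j b n)})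
      atTop (𝓝 (1 - q ^ (e - a))) := by
  have hp : ∀ i, 0 < p i := (hholds a le_rfl hae.le 0).pos (hN₀ 0)
  have hregs := LMLC.inf_eq_bot_of_chain hM hp hreg
  constructor
  · refine tendsto_rejection_probability hae M hM hN₀ hN hp hadm hreg hq₀ hq₁
      (fun j b n => statT (M (b + 1)) (M b) φ₁ (est j (b + 1) n) (est j b n))
      fun b hab hbe K ε hε => eventually_forall_of_approx (fun l hl hy htot => ?_) hε
    exact statT_approx (N := fun w : ℕ × (Fin k → ℕ) => N w.1) (n := Prod.snd) hφ₂ hφ₁ hp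
      (hN.comp (tendsto_comap.mono_left hl)) (fun w => hholds b hab hbe.le w.1)
      (fun w => hholds (b + 1) (by omega) hbe w.1) (hregs b hab hbe.le)
      (hregs (b + 1) (by omega) hbe) hy htot
      (est := fun w => est w.1 b) (fun w => hest w.1 b hab hbe.le)
      (est' := fun w => est w.1 (b + 1)) (fun w => hest w.1 (b + 1) (by omega) hbe)
  · refine tendsto_rejection_probability hae M hM hN₀ hN hp hadm hreg hq₀ hq₁
      (fun j b n => statS (M (b + 1)) (M b) φ₂ n (est j (b + 1) n) (est j b n))
      fun b hab hbe K ε hε => eventually_forall_of_approx (fun l hl hy htot => ?_) hε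
    exact statS_approx (N := fun w : ℕ × (Fin k → ℕ) => N w.1) (n := Prod.snd) hφ₂
      (hM b hab hbe) hp
      (hN.comp (tendsto_comap.mono_left hl)) (fun w => hholds b hab hbe.le w.1)
      (fun w => hholds (b + 1) (by omega) hbe w.1) (hregs b hab hbe.le)
      (hregs (b + 1) (by omega) hbe) hy htot
      (est := fun w => est w.1 b) (fun w => hest w.1 b hab hbe.le)
      (est' := fun w => est w.1 (b + 1)) (fun w => hest w.1 (b + 1) (by omega) hbe)

theorem theorem12 {k : ℕ} (S : SamplingPlan k) (B : ℕ) (hB : 2 ≤ B)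
    -- the models `M 1, ..., M B`
    (M : ℕ → LMLC S)
    (hM : ∀ b, 1 ≤ b → b < B → LMLC.NestedWithin (M (b + 1)) (M b))
    (φ₁ φ₂ : ℝ → EReal) (hφ₁ : IsPhi φ₁) (hφ₂ : IsPhi φ₂)
    (α : ℝ) (hα₀ : 0 < α) (hα₁ : α < 1)
    -- the expected total counts along the asymptotics
    (N : ℕ → ℝ) (hN₀ : ∀ j, 0 < N j) (hN : Tendsto N atTop atTop)
    -- the minimum `φ₂`-divergence estimators in the models
    (est : ℕ → (b : ℕ) → (Fin k → ℕ) → Fin (M b).t → ℝ)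
    (hest : ∀ j b, 1 ≤ b → b ≤ B → IsMinPhiEstimator (M b) φ₂ (N j) (est j b))
    -- the true normalized mean vector
    (p : Fin k → ℝ) (hp : ∑ i, p i = 1) (hadm : ∀ j, S.Admissible (N j • p)) :
    -- each test has asymptotic size `1 - (1 - α)^(1/(B-1))` under its own null hypothesis
    (∀ b, 1 ≤ b → b < B →
      (∀ j, (M b).Holds (N j) (N j • p)) → (∀ j, (M (b + 1)).Holds (N j) (N j • p)) →
      (M (b + 1)).RegularAt p →
      Tendsto (fun j => (S.law (N j • p)).real
        {n | (cutpoint (M (b + 1)) (M b) B α : EReal) <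
          statT (M (b + 1)) (M b) φ₁ (est j (b + 1) n) (est j b n)})
        atTop (𝓝 (1 - (1 - α) ^ (1 / ((B : ℝ) - 1)))) ∧
      Tendsto (fun j => (S.law (N j • p)).real
        {n | (cutpoint (M (b + 1)) (M b) B α : EReal) <
          statS (M (b + 1)) (M b) φ₂ n (est j (b + 1) n) (est j b n)})
        atTop (𝓝 (1 - (1 - α) ^ (1 / ((B : ℝ) - 1))))) ∧
    -- the overall asymptotic size, when all null hypotheses hold, is `α`
    ((∀ b, 1 ≤ b → b ≤ B → ∀ j, (M b).Holds (N j) (N j • p)) →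
      (M B).RegularAt p →
      Tendsto (fun j => (S.law (N j • p)).real
        {n | ∃ b, 1 ≤ b ∧ b < B ∧ (cutpoint (M (b + 1)) (M b) B α : EReal) <
          statT (M (b + 1)) (M b) φ₁ (est j (b + 1) n) (est j b n)})
        atTop (𝓝 α) ∧
      Tendsto (fun j => (S.law (N j • p)).real
        {n | ∃ b, 1 ≤ b ∧ b < B ∧ (cutpoint (M (b + 1)) (M b) B α : EReal) <
          statS (M (b + 1)) (M b) φ₂ n (est j (b + 1) n) (est j b n)})
        atTop (𝓝 α)) := by
  have hB' : (0 : ℝ) < (B : ℝ) - 1 := by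
    have : (2 : ℝ) ≤ B := by exact_mod_cast hB
    linarith
  have hq₀ : 0 < (1 - α) ^ (1 / ((B : ℝ) - 1)) := Real.rpow_pos_of_pos (by linarith) _
  have hq₁ : (1 - α) ^ (1 / ((B : ℝ) - 1)) < 1 :=
    Real.rpow_lt_one (by linarith) (by linarith) (by positivity)
  constructor
  · intro b hb hbB hholds hholds' hreg
    have hsingle : ∀ P : ℕ → Prop, (∃ b', b ≤ b' ∧ b' < b + 1 ∧ P b') ↔ P b := fun P =>
      ⟨fun ⟨b', h1, h2, h3⟩ => (by omega : b' = b) ▸ h3, fun h => ⟨b, le_rfl, by omega, h⟩⟩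
    have hmem : ∀ b', b ≤ b' → b' ≤ b + 1 → b' = b ∨ b' = b + 1 := by omega
    -- A single test is the chain from b to b + 1, with exponent 1.
    have := tendsto_rejection_statT_statS (Nat.lt_succ_self b) M
      (fun b' h1 h2 => hM b' (by omega) (by omega)) hφ₁ hφ₂ hN₀ hN
      (fun j b' h1 h2 => hest j b' (by omega) (by omega)) hadm
      (fun b' h1 h2 => by rcases hmem b' h1 h2 with rfl | rfl <;> assumption) hreg hq₀ hq₁
    simp only [hsingle, Nat.succ_eq_add_one, Nat.add_sub_cancel_left, pow_one] at this
    exact this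
  · intro hholds hreg
    have hpow : 1 - ((1 - α) ^ (1 / ((B : ℝ) - 1))) ^ (B - 1) = α := by
      rw [← Real.rpow_natCast, ← Real.rpow_mul (by linarith), Nat.cast_sub (by omega),
        Nat.cast_one, one_div_mul_cancel hB'.ne', Real.rpow_one]
      ring
    have := tendsto_rejection_statT_statS (show 1 < B by omega) M hM hφ₁ hφ₂ hN₀ hN hest hadm
      hholds hreg hq₀ hq₁
    rwa [hpow] at this
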